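/- Let $\Sigma$ be a finite alphabet containing two distinct letters $0,1$; $\Sigma^*$ (finite words) carries the discrete topology and $\Sigma^\omega$ (infinite sequences) the Cantor topology. A multi-function $f:A\rightrightarrows B$ assigns to every $a\in A$ a set $f(a)\subseteq B$, and $\mathrm{dom}(f)=\{a\mid f(a)\neq\emptyset\}$; it is a partial function if every $f(a)$ has at most one element. A partial function is \emph{continuous} if it is continuous on its domain with the subspace topology. A partial function $f:\subseteq Z_1\times\dots\times Z_n\to Z_0$ with all $Z_j\in\{\Sigma^*,\Sigma^\omega\}$ is \emph{computable} if it has an extension that is the function computed by some Type-2 machine, i.e. by a deterministic multi-tape Turing machine with $n$ input tapes, finitely many work tapes and a one-way output tape (output $w\in\Sigma^*$: the machine halts with $w$ on the output tape; output $q\in\Sigma^\omega$: the machine computes forever and writes $q$). A \emph{generalized Turing machine} (GTM) has Tapes $0,\dots,L$ (Tapes $1,\dots,k$ for input, $0\le k\le L$, Tape $0$ for output), a finite set of labels with an initial label $l_0$ and a final label $l_f$, a finite work alphabet $\Gamma$ with a blank, and sets $Y_0,\dots,Y_L$ disjoint from $\Gamma$; each cell (indexed by $\mathbb Z$) of Tape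 $i$ holds an element of $Y_i\cup\Gamma$. Every label $l\neq l_f$ carries one statement: move the head of Tape $i$ one cell right or left and go to $l'$; write $a\in\Gamma$ on the scanned cell of Tape $i$ and go to $l'$; go to $l'$ if $a\in\Gamma$ is scanned on Tape $i$, else to $l''$; write some element of $f(x_{i_1},\dots,x_{i_n})$ on the scanned cell of Tape $i$ and go to $l'$, where $f:Y_{i_1}\times\dots\times Y_{i_n}\rightrightarrows Y_i$ is a multi-function and $x_j$ is the content of the scanned cell of Tape $j$; go to $l'$ if $f(x_{i_1},\dots,x_{i_n})=0$ and to $l''$ if it is $1$, where $f:\subseteq Y_{i_1}\times\dots\times Y_{i_n}\to\Sigma^*$ is a partial function with range in $\{0,1\}$. If the statement cannot be executed there is no successor configuration, and neither is there one at $l_f$. On input $(x_1,\dots,x_k)\in Y_1\times\dots\times Y_k$ the machine starts with label $l_0$, all heads at position $0$, $x_i$ in cell $0$ of Tape $i$ ($1\le i\le k$), and all other cells blank. A configuration is accepting if its label is $l_f$ and cell $0$ of Tape $0$ contains an element of $Y_0$ (its result); a computation is accepting if it is finite and ends in an accepting configuration. The multi-function $f_N:Y_1\times\dots\times Y_k\rightrightarrows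 Y_0$ computed by a GTM $N$ is defined by: $x_0\in f_N(x_1,\dots,x_k)$ iff every maximal computation of $N$ on this input is accepting and some accepting computation on this input has the result $x_0$. \textbf{Claim.} Let $N$ be a GTM such that $Y_i\in\{\Sigma^*,\Sigma^\omega\}$ for $0\le i\le L$. (1) If all functions used in the statements of $N$ (in assignments and in tests) are continuous partial functions, then $f_N$ is a continuous partial function. (2) If all functions used in the statements of $N$ are computable partial functions, then $f_N$ is a computable partial function. -/

import Mathlib

namespace GenTM

/-! Multi-functions -/

/-- A multi-function `A ⇉ B`, given by the set `f a` of acceptable results at every `a`.  A partial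
function is a multi-function that is single-valued. -/
def MultiFun (A B : Type) : Type := A → Set B

namespace MultiFun

variable {A B : Type}

/-- The domain: all points at which there is some result. -/
def dom (f : MultiFun A B) : Set A := {a | (f a).Nonempty}

/-- `f` is a partial function. -/
def SingleValued (f : MultiFun A B) : Prop := ∀ a, (f a).Subsingleton

/-- The partial function `f` is continuous, i.e. it is single-valued, and continuous on its domain,
which carries the subspace topology. -/
def IsContinuous [TopologicalSpace A] [TopologicalSpace B] (f : MultiFun A B) : Prop :=
  f.SingleValued ∧ ∃ g : f.dom → B, Continuous g ∧ ∀ a : f.dom, g a ∈ f a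

end MultiFun

/-! Finite and infinite sequences over an alphabet -/

/-- The two kinds of sequence spaces. -/
inductive Kind
  | word
  | stream

/-- The set of finite words, respectively of infinite sequences, over the alphabet `S`. -/
def Str (S : Type) : Kind → Type
  | .word => List S
  | .stream => ℕ → S

/-- The discrete topology on words; the Cantor topology (the product of the discrete topologies) on
infinite sequences. -/
instance Str.topology (S : Type) : (t : Kind) → TopologicalSpace (Str S t)
  | .word => (⊥ : TopologicalSpace (List S))
  | .stream => @Pi.topologicalSpace ℕ (fun _ => S) (fun _ => ⊥)

/-- The inscription of a two-way infinite tape that holds the given sequence from cell `0` on;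
`none` is the blank. -/
def Str.symbolAt {S : Type} : {t : Kind} → Str S t → ℤ → Option S
  | .word, w, z => if 0 ≤ z then (show List S from w)[z.toNat]? else none
  | .stream, p, z => if 0 ≤ z then some ((show ℕ → S from p) z.toNat) else none

/-- A single letter as a word. -/
def letter {S : Type} (a : S) : Str S .word := ([a] : List S)

/-! Type-2 machines -/

/-- What a Type-2 machine does in one step: next state, motion of the heads on the input tapes
(`none` = stay), symbols written on the work tapes, motion of the heads on the work tapes, and
possibly a symbol that is appended to the output. -/
structure Action (S State Work : Type) (n m : ℕ) where
  next : State
  inMove : Fin n → Option Turing.Dir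
  write : Fin m → Work
  workMove : Fin m → Option Turing.Dir
  out : Option S

/-- A deterministic multi-tape machine with finite control, `n` (read-only) input tapes, finitely
many work tapes over a finite work alphabet (with blank symbol `default`), and a one-way output tape
over `S`.  In every step the machine sees its state and the scanned symbols on the input and the
work tapes; it halts where `δ` is `none`. -/
structure Type2Machine (S : Type) (n : ℕ) where
  State : Type
  [finState : Finite State]
  Work : Type
  [finWork : Finite Work]
  [blank : Inhabited Work]
  numWork : ℕ
  start : State
  δ : State → (Fin n → Option S) → (Fin numWork → Work) → Option (Action S State Work n numWork)

namespace Type2Machine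

variable {S : Type} {n : ℕ}

attribute [instance] Type2Machine.finState Type2Machine.finWork Type2Machine.blank

/-- Configurations; `out` is the word written so far on the output tape. -/
structure Cfg (M : Type2Machine S n) where
  state : M.State
  inHead : Fin n → ℤ
  work : Fin M.numWork → Turing.Tape M.Work
  out : List S

/-- Displacement of a head. -/
def shift : Option Turing.Dir → ℤ
  | none => 0
  | some .left => -1
  | some .right => 1

/-- Motion of a work tape relative to its head. -/
def moveTape {G : Type} [Inhabited G] : Option Turing.Dir → Turing.Tape G → Turing.Tape G
  | none, T => T
  | some d, T => T.move d

variable (M : Type2Machine S n) {Y : Fin n → Kind}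

/-- All heads at cell `0`, work tapes blank, nothing written. -/
def init : M.Cfg :=
  ⟨M.start, fun _ => 0, fun _ => default, []⟩

/-- One step on the input `p`. -/
def step (p : ∀ j, Str S (Y j)) (c : M.Cfg) : Option M.Cfg :=
  (M.δ c.state (fun j => (p j).symbolAt (c.inHead j)) (fun r => (c.work r).head)).map fun a =>
    { state := a.next
      inHead := fun j => c.inHead j + shift (a.inMove j)
      work := fun r => moveTape (a.workMove r) ((c.work r).write (a.write r))
      out := c.out ++ a.out.toList }

/-- The configuration after `s` steps on the input `p`, if the machine makes that many steps. -/
def run (p : ∀ j, Str S (Y j)) : ℕ → Option M.Cfg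
  | 0 => some M.init
  | s + 1 => (run p s).bind (M.step p)

/-- The function computed by the machine with the type specification `(Y₁, …, Yₙ → Y₀)`.
For words as output: the machine halts with `w` on the output tape.
For infinite sequences as output: the machine computes forever and writes `q`. -/
def fn (Y : Fin n → Kind) : (Y₀ : Kind) → MultiFun (∀ j, Str S (Y j)) (Str S Y₀)
  | .word => fun p => {w | ∃ s c, M.run p s = some c ∧ M.step p c = none ∧ c.out = w}
  | .stream => fun p => {q : ℕ → S | (∀ s, M.run p s ≠ none) ∧
      ∀ m, ∃ s c, M.run p s = some c ∧ c.out[m]? = some (q m)}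

end Type2Machine

/-- `f` is the function of some Type-2 machine. -/
def IsTuringComputable {S : Type} {n : ℕ} (Y : Fin n → Kind) (Y₀ : Kind)
    (f : MultiFun (∀ j, Str S (Y j)) (Str S Y₀)) : Prop :=
  ∃ M : Type2Machine S n, f = M.fn Y Y₀

/-- The partial function `f` is computable, i.e. has a Turing computable extension. -/
def IsComputable {S : Type} {n : ℕ} (Y : Fin n → Kind) (Y₀ : Kind)
    (f : MultiFun (∀ j, Str S (Y j)) (Str S Y₀)) : Prop :=
  f.SingleValued ∧ ∃ g, IsTuringComputable Y Y₀ g ∧ ∀ p, f p ⊆ g p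

/-! Generalized Turing machines -/

/-- The statements of a generalized Turing machine with tapes `0, …, L`, labels `Lab`, work alphabet
`Γ`, and the set `X i` associated with Tape `i`.  `zero` and `one` are the letters `0, 1` of the
alphabet `S`, with the words `0` (true) and `1` (false) as results of tests. -/
inductive Stm {S : Type} (zero one : S) (Lab Γ : Type) {L : ℕ} (X : Fin (L + 1) → Type) : Type
  | right (i : Fin (L + 1)) (l' : Lab)
  | left (i : Fin (L + 1)) (l' : Lab)
  | write (i : Fin (L + 1)) (a : Γ) (l' : Lab)
  | branch (i : Fin (L + 1)) (a : Γ) (l' l'' : Lab)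
  | assign (i : Fin (L + 1)) {n : ℕ} (is : Fin n → Fin (L + 1))
      (f : MultiFun (∀ j, X (is j)) (X i)) (l' : Lab)
  | test {n : ℕ} (is : Fin n → Fin (L + 1)) (f : MultiFun (∀ j, X (is j)) (Str S .word))
      (singleValued : f.SingleValued) (range_sub : ∀ x, f x ⊆ {letter zero, letter one})
      (l' l'' : Lab)

/-- A generalized Turing machine: Tapes `1, …, k` are the input tapes, Tape `0` is the output tape.
A cell of Tape `i` contains an element of the disjoint union of `X i` and the work alphabet. -/
structure GTM {S : Type} (zero one : S) (k L : ℕ) (X : Fin (L + 1) → Type) where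
  k_le : k ≤ L
  Lab : Type
  [finLab : Finite Lab]
  start : Lab
  final : Lab
  Γ : Type
  [finΓ : Finite Γ]
  blank : Γ
  stm : {l : Lab // l ≠ final} → Stm zero one Lab Γ X

namespace GTM

variable {S : Type} {zero one : S} {k L : ℕ} {X : Fin (L + 1) → Type}

/-- Configurations: label, tape inscriptions, head positions. -/
structure Cfg (M : GTM zero one k L X) where
  label : M.Lab
  tape : ∀ i, ℤ → X i ⊕ M.Γ
  head : Fin (L + 1) → ℤ

variable {M : GTM zero one k L X}

/-- The content of the cell scanned by the head on Tape `i`. -/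
def Cfg.scan (κ : M.Cfg) (i : Fin (L + 1)) : X i ⊕ M.Γ := κ.tape i (κ.head i)

def Cfg.setLabel (κ : M.Cfg) (l : M.Lab) : M.Cfg := { κ with label := l }

def Cfg.setHead (κ : M.Cfg) (i : Fin (L + 1)) (m : ℤ) : M.Cfg :=
  { κ with head := Function.update κ.head i m }

/-- Write `x` under the head of Tape `i`. -/
def Cfg.setCell (κ : M.Cfg) (i : Fin (L + 1)) (x : X i ⊕ M.Γ) : M.Cfg :=
  { κ with tape := Function.update κ.tape i (Function.update (κ.tape i) (κ.head i) x) }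

variable (M)

/-- The successor relation for one statement. -/
def StmStep (κ κ' : M.Cfg) : Stm zero one M.Lab M.Γ X → Prop
  | .right i l' => κ' = (κ.setHead i (κ.head i + 1)).setLabel l'
  | .left i l' => κ' = (κ.setHead i (κ.head i - 1)).setLabel l'
  | .write i a l' => κ' = (κ.setCell i (.inr a)).setLabel l'
  | .branch i a l' l'' =>
      (κ.scan i = .inr a ∧ κ' = κ.setLabel l') ∨ (κ.scan i ≠ .inr a ∧ κ' = κ.setLabel l'')
  | .assign i is f l' =>
      ∃ x : ∀ j, X (is j), (∀ j, κ.scan (is j) = .inl (x j)) ∧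
        ∃ y ∈ f x, κ' = (κ.setCell i (.inl y)).setLabel l'
  | .test is f _ _ l' l'' =>
      ∃ x : ∀ j, X (is j), (∀ j, κ.scan (is j) = .inl (x j)) ∧
        ((letter zero ∈ f x ∧ κ' = κ.setLabel l') ∨ (letter one ∈ f x ∧ κ' = κ.setLabel l''))

/-- The successor relation; configurations with the final label have no successor. -/
def Step (κ κ' : M.Cfg) : Prop :=
  ∃ h : κ.label ≠ M.final, M.StmStep κ κ' (M.stm ⟨κ.label, h⟩)

/-- `(κ 0, κ 1, …)`, ending with `κ n` if `n` is finite, and infinite if `n = ⊤`, is a computation.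
The values of `κ` beyond `n` are irrelevant. -/
def IsComputation (n : ℕ∞) (κ : ℕ → M.Cfg) : Prop :=
  ∀ s : ℕ, (s : ℕ∞) < n → M.Step (κ s) (κ (s + 1))

/-- The computation is infinite or its last configuration has no successor. -/
def IsMaximal (n : ℕ∞) (κ : ℕ → M.Cfg) : Prop :=
  n = ⊤ ∨ ∃ s : ℕ, n = s ∧ ∀ κ', ¬ M.Step (κ s) κ'

/-- The label is final and cell `0` of Tape `0` contains the element `x₀` of `X 0`. -/
def AcceptsWith (κ : M.Cfg) (x₀ : X 0) : Prop :=
  κ.label = M.final ∧ κ.tape 0 0 = .inl x₀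

/-- The computation is finite and its last configuration is accepting. -/
def IsAccepting (n : ℕ∞) (κ : ℕ → M.Cfg) : Prop :=
  ∃ s : ℕ, n = s ∧ ∃ x₀, M.AcceptsWith (κ s) x₀

/-- The number of the `j`-th input tape: `0, …, k - 1` become `1, …, k`. -/
def inTape (j : Fin k) : Fin (L + 1) := (Fin.castLE M.k_le j).succ

/-- The initial configuration: the inputs are in the cells `0` of the input tapes, all other cells
are blank, all heads are at position `0`. -/
def initCfg (x : ∀ j, X (M.inTape j)) : M.Cfg where
  label := M.start
  tape := Fin.cases (motive := fun i => ℤ → X i ⊕ M.Γ) (fun _ => .inr M.blank)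
    (fun i z => if h : i.1 < k ∧ z = 0 then .inl (x ⟨i.1, h.1⟩) else .inr M.blank)
  head := fun _ => 0

/-- The multi-function computed by the machine. -/
def fn : MultiFun (∀ j, X (M.inTape j)) (X 0) := fun x =>
  {x₀ | (∀ n κ, M.IsComputation n κ → κ 0 = M.initCfg x → M.IsMaximal n κ → M.IsAccepting n κ) ∧
    ∃ (s : ℕ) (κ : ℕ → M.Cfg), M.IsComputation s κ ∧ κ 0 = M.initCfg x ∧ M.AcceptsWith (κ s) x₀}

end GTM

/-- The function used in a statement (if there is one) has the property `P`, for machines whose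
tape sets are given by the kinds `Y 0, …, Y L`. -/
def Stm.Uses {S : Type} {zero one : S} {Lab Γ : Type} {L : ℕ} {Y : Fin (L + 1) → Kind}
    (P : ∀ {n : ℕ} (Z : Fin n → Kind) (Z₀ : Kind), MultiFun (∀ j, Str S (Z j)) (Str S Z₀) → Prop) :
    Stm zero one Lab Γ (fun i => Str S (Y i)) → Prop
  | .assign i is f _ => P (fun j => Y (is j)) (Y i) f
  | .test is f _ _ _ _ => P (fun j => Y (is j)) .word f
  | _ => True

end GenTM

/-!
Continuity. For single-valued statement functions a configuration has at most one successor, which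
depends continuously on it when label and head positions are discrete. Hence so does the
configuration that is reached after any finite number of steps, and an accepting computation on
one input shows what happens on all inputs in a neighbourhood that have a result.

Computability. A computable function on sequences is a limit of a primitive recursive function on
words: from finite prefixes of the arguments and a bound for the effort it yields prefixes of the
value. A generalized Turing machine can be run with words in place of the elements of `Y i`, where
every statement function is replaced by its approximation; since an accepting computation executes
only finitely many statements, good enough approximations of the inputs carry this run through to
the end. So `f_N` is approximated by a primitive recursive function as well. Conversely, a Type-2
machine computes an approximable function by trying longer and longer prefixes of the inputs. The
end of a finite input must have been seen before the approximation is used, and what has been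
written remains correct, since all approximations are prefixes of the same value. The machine
evaluates the partial recursive functions that control this search by simulation of the stack
machines of `Turing.PartrecToTM2`, with its work tapes as stacks.
-/

open Filter Topology

namespace GenTM

/-! ### Continuity -/

namespace MultiFun

variable {A B C : Type}

/-- The composition of two multi-functions: all results of `g` at results of `f`. -/
def comp (g : MultiFun B C) (f : MultiFun A B) : MultiFun A C := fun a => {c | ∃ b ∈ f a, c ∈ g b}

/-- A function, as a multi-function. -/
def ofFun (f : A → B) : MultiFun A B := fun a => {f a}

variable [TopologicalSpace A] [TopologicalSpace B] [TopologicalSpace C]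

theorem isContinuous_iff {f : MultiFun A B} :
    f.IsContinuous ↔
      f.SingleValued ∧ ∀ a, ∀ b ∈ f a, ∀ V ∈ 𝓝 b, ∀ᶠ a' in 𝓝 a, f a' ⊆ V := by
  refine and_congr_right fun hs => ⟨?_, fun h => ?_⟩
  · rintro ⟨g, hg, hgf⟩ a b hb V hV
    have hgb : g ⟨a, b, hb⟩ = b := hs a (hgf ⟨a, b, hb⟩) hb
    obtain ⟨U, hU, hUV⟩ := (mem_nhds_subtype _ _ _).1
      (hg.continuousAt.preimage_mem_nhds (hgb ▸ hV))
    filter_upwards [hU] with a' ha' b' hb'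
    have hgb' : g ⟨a', b', hb'⟩ = b' := hs a' (hgf ⟨a', b', hb'⟩) hb'
    exact hgb' ▸ hUV (show (⟨a', b', hb'⟩ : f.dom) ∈ _ from ha')
  · choose g hg using fun a : f.dom => a.2
    refine ⟨g, continuous_iff_continuousAt.2 fun a V hV => ?_, hg⟩
    have hfV := continuous_subtype_val.continuousAt.eventually (h a (g a) (hg a) V hV)
    exact hfV.mono fun a' ha' => ha' (hg a')

theorem isContinuous_iff_singleValued [DiscreteTopology A] {f : MultiFun A B} :
    f.IsContinuous ↔ f.SingleValued := by
  refine isContinuous_iff.trans ⟨And.left, fun hs => ⟨hs, fun a b hb V hV => ?_⟩⟩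
  rw [nhds_discrete, eventually_pure]
  exact fun b' hb' => hs a hb hb' ▸ mem_of_mem_nhds hV

theorem isContinuous_ofFun {f : A → B} (hf : Continuous f) : (ofFun f).IsContinuous :=
  ⟨fun _ => Set.subsingleton_singleton, fun a => f a, hf.comp continuous_subtype_val, fun _ => rfl⟩

theorem IsContinuous.mono {f g : MultiFun A B} (hf : f.IsContinuous) (hgf : ∀ a, g a ⊆ f a) :
    g.IsContinuous := by
  rw [isContinuous_iff] at hf ⊢
  exact ⟨fun a => (hf.1 a).anti (hgf a), fun a b hb V hV =>
    (hf.2 a b (hgf a hb) V hV).mono fun a' ha' => (hgf a').trans ha'⟩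

theorem IsContinuous.comp {g : MultiFun B C} {f : MultiFun A B} (hg : g.IsContinuous)
    (hf : f.IsContinuous) : (g.comp f).IsContinuous := by
  rw [isContinuous_iff] at *
  refine ⟨?_, ?_⟩
  · rintro a c ⟨b, hb, hc⟩ c' ⟨b', hb', hc'⟩
    exact hg.1 b hc (hf.1 a hb' hb ▸ hc')
  · rintro a c ⟨b, hb, hc⟩ V hV
    filter_upwards [hf.2 a b hb _ (hg.2 b c hc V hV)] with a' ha' c' ⟨b', hb', hc'⟩
    exact ha' hb' hc'

theorem IsContinuous.image {f : MultiFun A B} (hf : f.IsContinuous) {h : A × B → C}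
    (hh : Continuous h) : MultiFun.IsContinuous fun a => {c | ∃ b ∈ f a, c = h (a, b)} := by
  rw [isContinuous_iff] at hf
  refine isContinuous_iff.2 ⟨?_, ?_⟩
  · rintro a _ ⟨b, hb, rfl⟩ _ ⟨b', hb', rfl⟩
    rw [hf.1 a hb hb']
  · rintro a _ ⟨b, hb, rfl⟩ V hV
    obtain ⟨U, hU, W, hW, hUW⟩ := mem_nhds_prod_iff.1 (hh.continuousAt.preimage_mem_nhds hV)
    filter_upwards [hU, hf.2 a b hb W hW] with a' ha' hfW
    rintro _ ⟨b', hb', rfl⟩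
    exact hUW (Set.mk_mem_prod ha' (hfW hb'))

end MultiFun

instance Str.discreteTopology_word (S : Type) : DiscreteTopology (Str S .word) := ⟨rfl⟩

theorem letter_injective {S : Type} : Function.Injective (letter : S → Str S .word) :=
  fun _ _ h => List.singleton_injective h

namespace Stm

variable {S : Type} {zero one : S} {Lab Γ : Type} {L : ℕ}

theorem Uses.mono {Y : Fin (L + 1) → Kind}
    {P Q : ∀ {n : ℕ} (Z : Fin n → Kind) (Z₀ : Kind),
      MultiFun (∀ j, Str S (Z j)) (Str S Z₀) → Prop}
    (hPQ : ∀ {n : ℕ} (Z : Fin n → Kind) (Z₀ : Kind) (f), P Z Z₀ f → Q Z Z₀ f)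
    {q : Stm zero one Lab Γ (fun i => Str S (Y i))} (h : q.Uses P) : q.Uses Q := by
  cases q with
  | assign | test => exact hPQ _ _ _ h
  | _ => trivial

variable {X : Fin (L + 1) → Type}

/-- The function used in a statement (if there is one) is a continuous partial function. In contrast
to `Stm.Uses`, the spaces `X i` are arbitrary. -/
def IsContinuous [∀ i, TopologicalSpace (X i)] : Stm zero one Lab Γ X → Prop
  | assign _ _ f _ => f.IsContinuous
  | test _ f _ _ _ _ => f.IsContinuous
  | _ => True

/-- The function used in a statement (if there is one) is a partial function; in tests, this holds
by the definition of `Stm`. -/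
def SingleValued : Stm zero one Lab Γ X → Prop
  | assign _ _ f _ => f.SingleValued
  | _ => True

theorem Uses.isContinuous {Y : Fin (L + 1) → Kind} {q : Stm zero one Lab Γ (fun i => Str S (Y i))}
    (h : q.Uses fun _ _ f => f.IsContinuous) : q.IsContinuous := by
  cases q <;> exact h

theorem Uses.singleValued {Y : Fin (L + 1) → Kind} {q : Stm zero one Lab Γ (fun i => Str S (Y i))}
    (h : q.Uses fun _ _ f => f.SingleValued) : q.SingleValued := by
  cases q with
  | assign => exact h
  | _ => trivial

theorem SingleValued.isContinuous [∀ i, TopologicalSpace (X i)] [∀ i, DiscreteTopology (X i)]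
    {q : Stm zero one Lab Γ X} (hq : q.SingleValued) : q.IsContinuous := by
  cases q with
  | assign => exact MultiFun.isContinuous_iff_singleValued.2 hq
  | test is f hs => exact MultiFun.isContinuous_iff_singleValued.2 hs
  | _ => trivial

end Stm

namespace GTM

variable {S : Type} {zero one : S} {k L : ℕ} {X : Fin (L + 1) → Type} {N : GTM zero one k L X}

instance labTopology : TopologicalSpace N.Lab := ⊥
instance lab_discreteTopology : DiscreteTopology N.Lab := ⟨rfl⟩
instance workTopology : TopologicalSpace N.Γ := ⊥
instance work_discreteTopology : DiscreteTopology N.Γ := ⟨rfl⟩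

namespace Cfg

variable [∀ i, TopologicalSpace (X i)]

/-- Pointwise convergence of the tape inscriptions, with discrete labels and head positions. -/
instance topology : TopologicalSpace N.Cfg :=
  .induced (fun κ => (κ.label, κ.tape, κ.head)) inferInstance

theorem continuous_components :
    Continuous fun κ : N.Cfg => (κ.label, κ.tape, κ.head) :=
  continuous_induced_dom

theorem continuous_label : Continuous (label : N.Cfg → N.Lab) :=
  continuous_components.fst

theorem continuous_tape : Continuous (tape : N.Cfg → ∀ i, ℤ → X i ⊕ N.Γ) :=
  continuous_components.snd.fst

theorem continuous_head : Continuous (head : N.Cfg → Fin (L + 1) → ℤ) :=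
  continuous_components.snd.snd

theorem eventually_label_eq (κ : N.Cfg) : ∀ᶠ κ' in 𝓝 κ, κ'.label = κ.label :=
  continuous_label.continuousAt.preimage_mem_nhds (mem_nhds_discrete (s := {κ.label}) |>.2 rfl)

theorem continuous_mk {A : Type*} [TopologicalSpace A] {κ : A → N.Cfg}
    (hlabel : Continuous fun a => (κ a).label) (htape : Continuous fun a => (κ a).tape)
    (hhead : Continuous fun a => (κ a).head) : Continuous κ :=
  continuous_induced_rng.2 (hlabel.prodMk (htape.prodMk hhead))

theorem continuous_setLabel : Continuous fun p : N.Cfg × N.Lab => p.1.setLabel p.2 :=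
  continuous_mk continuous_snd continuous_tape.fst' continuous_head.fst'

theorem continuous_setHead (i : Fin (L + 1)) : Continuous fun p : N.Cfg × ℤ => p.1.setHead i p.2 :=
  continuous_mk continuous_label.fst' continuous_tape.fst'
    (continuous_head.fst'.update i continuous_snd)

theorem continuous_setCell (i : Fin (L + 1)) :
    Continuous fun p : N.Cfg × (X i ⊕ N.Γ) => p.1.setCell i p.2 := by
  have hupdate : Continuous fun p : ((ℤ → X i ⊕ N.Γ) × (X i ⊕ N.Γ)) × ℤ =>
      Function.update p.1.1 p.2 p.1.2 :=
    continuous_prod_of_discrete_right.2 fun z => continuous_fst.update z continuous_snd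
  have htape : Continuous fun p : N.Cfg × (X i ⊕ N.Γ) => p.1.tape := continuous_tape.fst'
  have hhead : Continuous fun p : N.Cfg × (X i ⊕ N.Γ) => p.1.head := continuous_head.fst'
  exact continuous_mk continuous_label.fst'
    (htape.update i (hupdate.comp ((((continuous_apply i).comp htape).prodMk continuous_snd).prodMk
      ((continuous_apply i).comp hhead))))
    hhead

theorem continuous_scan (i : Fin (L + 1)) : Continuous fun κ : N.Cfg => κ.scan i := by
  have heval : Continuous fun p : (ℤ → X i ⊕ N.Γ) × ℤ => p.1 p.2 :=
    continuous_prod_of_discrete_right.2 fun z => continuous_apply z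
  exact heval.comp (((continuous_apply i).comp continuous_tape).prodMk
    ((continuous_apply i).comp continuous_head))

theorem isClopen_scan_eq_inr (i : Fin (L + 1)) (a : N.Γ) :
    IsClopen {κ : N.Cfg | κ.scan i = .inr a} := by
  have hinr : IsClopen ({.inr a} : Set (X i ⊕ N.Γ)) := by
    rw [← Set.image_singleton]
    exact ⟨IsClosedEmbedding.inr.isClosedMap _ (isClosed_discrete _),
      isOpenMap_inr _ (isOpen_discrete _)⟩
  exact hinr.preimage (continuous_scan i)

/-- The arguments that are scanned on the tapes `is j`, as a partial function. -/
def args {n : ℕ} (is : Fin n → Fin (L + 1)) : MultiFun N.Cfg (∀ j, X (is j)) :=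
  fun κ => {x | ∀ j, κ.scan (is j) = .inl (x j)}

theorem args_isContinuous {n : ℕ} (is : Fin n → Fin (L + 1)) :
    (args is : MultiFun N.Cfg _).IsContinuous := by
  refine MultiFun.isContinuous_iff.2 ⟨fun κ x hx x' hx' => ?_, fun κ x hx V hV => ?_⟩
  · exact funext fun j => Sum.inl_injective ((hx j).symm.trans (hx' j))
  · have hinl : IsEmbedding (Pi.map fun j => (Sum.inl : X (is j) → X (is j) ⊕ N.Γ)) :=
      .piMap fun _ => .inl
    have hscan : Continuous fun (κ : N.Cfg) j => κ.scan (is j) :=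
      continuous_pi fun j => continuous_scan (is j)
    have scan_eq {κ : N.Cfg} {x} (hx : x ∈ args is κ) :
        (fun j => κ.scan (is j)) = Pi.map (fun _ => Sum.inl) x := funext hx
    rw [hinl.nhds_eq_comap, ← scan_eq hx] at hV
    obtain ⟨W, hW, hWV⟩ := hV
    filter_upwards [hscan.continuousAt.preimage_mem_nhds hW] with κ' hκ' x' hx'
    exact hWV (show _ ∈ W from scan_eq hx' ▸ hκ')

end Cfg

theorem stmStep_isContinuous [∀ i, TopologicalSpace (X i)] (h01 : zero ≠ one)
    {q : Stm zero one N.Lab N.Γ X} (hq : q.IsContinuous) :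
    MultiFun.IsContinuous fun κ => {κ' | N.StmStep κ κ' q} := by
  classical
  have moveHead (i : Fin (L + 1)) (d : ℤ) (l : N.Lab) :
      Continuous fun κ : N.Cfg => (κ.setHead i (κ.head i + d)).setLabel l :=
    Cfg.continuous_setLabel.comp (((Cfg.continuous_setHead i).comp (continuous_id.prodMk
      (((continuous_apply i).comp Cfg.continuous_head).add continuous_const))).prodMk
        continuous_const)
  have setCell (i : Fin (L + 1)) (l : N.Lab) :
      Continuous fun p : N.Cfg × (X i ⊕ N.Γ) => (p.1.setCell i p.2).setLabel l :=
    Cfg.continuous_setLabel.comp ((Cfg.continuous_setCell i).prodMk continuous_const)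
  cases q with
  | right i l' => exact MultiFun.isContinuous_ofFun (moveHead i 1 l')
  | left i l' => exact MultiFun.isContinuous_ofFun (moveHead i (-1) l')
  | write i a l' => exact MultiFun.isContinuous_ofFun ((setCell i l').comp (.prodMk_left _))
  | branch i a l' l'' =>
    have hlabel : Continuous fun κ : N.Cfg => if κ.scan i = .inr a then l' else l'' :=
      continuous_const.if (by simp [(Cfg.isClopen_scan_eq_inr i a).frontier_eq]) continuous_const
    refine (MultiFun.isContinuous_ofFun
      (Cfg.continuous_setLabel.comp (continuous_id.prodMk hlabel))).mono ?_
    rintro κ _ (⟨h, rfl⟩ | ⟨h, rfl⟩) <;> simp [MultiFun.ofFun, h]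
  | assign i is f l' =>
    have hf : f.IsContinuous := hq
    refine ((hf.comp (Cfg.args_isContinuous is)).image ((setCell i l').comp
      (continuous_id.prodMap continuous_inl))).mono ?_
    rintro κ _ ⟨x, hx, y, hy, rfl⟩
    exact ⟨y, ⟨x, hx, hy⟩, rfl⟩
  | test is f _ _ l' l'' =>
    have hf : f.IsContinuous := hq
    have hlabel : Continuous fun w : Str S .word => if w = letter zero then l' else l'' :=
      continuous_of_discreteTopology
    refine ((hf.comp (Cfg.args_isContinuous is)).image
      (Cfg.continuous_setLabel.comp (continuous_id.prodMap hlabel))).mono ?_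
    rintro κ _ ⟨x, hx, ⟨hy, rfl⟩ | ⟨hy, rfl⟩⟩
    · exact ⟨_, ⟨x, hx, hy⟩, by simp⟩
    · exact ⟨_, ⟨x, hx, hy⟩, by simp [letter_injective.eq_iff, h01.symm]⟩

theorem step_isContinuous [∀ i, TopologicalSpace (X i)] (h01 : zero ≠ one)
    (hN : ∀ l, (N.stm l).IsContinuous) : MultiFun.IsContinuous fun κ => {κ' | N.Step κ κ'} := by
  have hstm l hl := MultiFun.isContinuous_iff.1 (stmStep_isContinuous h01 (hN ⟨l, hl⟩))
  refine MultiFun.isContinuous_iff.2 ⟨?_, ?_⟩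
  · rintro κ κ₁ ⟨hl, h₁⟩ κ₂ ⟨_, h₂⟩
    exact (hstm κ.label hl).1 κ h₁ h₂
  · rintro κ κ₁ ⟨hl, h₁⟩ V hV
    filter_upwards [κ.eventually_label_eq, (hstm κ.label hl).2 κ κ₁ h₁ V hV] with κ' h hV κ₂ ⟨_, h₂⟩
    exact hV (show N.StmStep κ' κ₂ (N.stm ⟨κ.label, hl⟩) by simpa only [h] using h₂)

/-- The results of the accepting computations that begin with a given configuration. -/
def resultFrom (N : GTM zero one k L X) : MultiFun N.Cfg (X 0) := fun κ =>
  {x₀ | ∃ κ', Relation.ReflTransGen N.Step κ κ' ∧ N.AcceptsWith κ' x₀}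

theorem resultFrom_of_label_eq {κ : N.Cfg} (h : κ.label = N.final) :
    N.resultFrom κ = {x₀ | κ.tape 0 0 = .inl x₀} := by
  ext x₀
  refine ⟨?_, fun hx₀ => ⟨κ, .refl, h, hx₀⟩⟩
  rintro ⟨κ', hκ', ha⟩
  obtain rfl | ⟨κ₁, hs, -⟩ := hκ'.cases_head
  · exact ha.2
  · exact absurd h hs.1

theorem resultFrom_of_label_ne {κ : N.Cfg} (h : κ.label ≠ N.final) :
    N.resultFrom κ = N.resultFrom.comp (fun κ => {κ' | N.Step κ κ'}) κ := by
  ext x₀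
  constructor
  · rintro ⟨κ', hκ', ha⟩
    obtain rfl | ⟨κ₁, hs, hκ₁⟩ := hκ'.cases_head
    · exact absurd ha.1 h
    · exact ⟨κ₁, hs, κ', hκ₁, ha⟩
  · rintro ⟨κ₁, hs, κ', hκ₁, ha⟩
    exact ⟨κ', .head hs hκ₁, ha⟩

theorem fn_subset_resultFrom (x : ∀ j, X (N.inTape j)) : N.fn x ⊆ N.resultFrom (N.initCfg x) := by
  rintro x₀ ⟨-, s, κ, hκ, h0, ha⟩
  have reach (i : ℕ) (hi : i ≤ s) : Relation.ReflTransGen N.Step (κ 0) (κ i) := by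
    induction i with
    | zero => exact .refl
    | succ i ih => exact (ih (by omega)).tail (hκ i (by exact_mod_cast hi))
  exact ⟨κ s, h0 ▸ reach s le_rfl, ha⟩

theorem resultFrom_isContinuous [∀ i, TopologicalSpace (X i)] (h01 : zero ≠ one)
    (hN : ∀ l, (N.stm l).IsContinuous) : N.resultFrom.IsContinuous := by
  have hstep := MultiFun.isContinuous_iff.1 (step_isContinuous h01 hN)
  refine MultiFun.isContinuous_iff.2 ⟨?_, ?_⟩
  · rintro κ x₀ ⟨κ', hκ', ha⟩
    induction hκ' using Relation.ReflTransGen.head_induction_on with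
    | refl =>
      rw [resultFrom_of_label_eq ha.1]
      exact fun y₀ hy₀ => Sum.inl_injective (ha.2.symm.trans hy₀)
    | head hs _ ih =>
      rw [resultFrom_of_label_ne hs.1]
      rintro y₀ ⟨κ₂, hs₂, hy₀⟩
      exact ih (hstep.1 _ hs₂ hs ▸ hy₀)
  · rintro κ x₀ ⟨κ', hκ', ha⟩ V hV
    induction hκ' using Relation.ReflTransGen.head_induction_on with
    | refl =>
      have hcell : Continuous fun κ : N.Cfg => κ.tape 0 0 :=
        (continuous_apply 0).comp ((continuous_apply 0).comp Cfg.continuous_tape)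
      have hV' : Sum.inl '' V ∈ 𝓝 (κ'.tape 0 0) := ha.2 ▸ isOpenMap_inl.image_mem_nhds hV
      filter_upwards [κ'.eventually_label_eq, hcell.continuousAt.preimage_mem_nhds hV']
        with κ hl hκ
      rw [resultFrom_of_label_eq (hl.trans ha.1)]
      rintro y₀ hy₀
      obtain ⟨y, hy, e⟩ := hκ
      exact Sum.inl_injective (e.trans hy₀) ▸ hy
    | @head κ κ₁ hs _ ih =>
      filter_upwards [κ.eventually_label_eq, hstep.2 κ κ₁ hs _ ih] with κ' hl hκ'
      rw [resultFrom_of_label_ne (hl ▸ hs.1)]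
      rintro y₀ ⟨κ₂, hs₂, hy₀⟩
      exact hκ' hs₂ hy₀

theorem continuous_initCfg [∀ i, TopologicalSpace (X i)] : Continuous N.initCfg := by
  refine Cfg.continuous_mk continuous_const (continuous_pi fun i => continuous_pi fun z => ?_)
    continuous_const
  cases i using Fin.cases with
  | zero => exact continuous_const
  | succ i =>
    by_cases h : i.1 < k ∧ z = 0
    · simp only [initCfg, Fin.cases_succ, h, and_self, dite_true]
      exact continuous_inl.comp (continuous_apply _)
    · simp only [initCfg, Fin.cases_succ, h, dite_false]
      exact continuous_const

theorem fn_isContinuous [∀ i, TopologicalSpace (X i)] (h01 : zero ≠ one)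
    (hN : ∀ l, (N.stm l).IsContinuous) : N.fn.IsContinuous := by
  refine ((resultFrom_isContinuous h01 hN).comp
    (MultiFun.isContinuous_ofFun continuous_initCfg)).mono fun x x₀ hx₀ => ?_
  exact ⟨N.initCfg x, rfl, fn_subset_resultFrom x hx₀⟩

theorem fn_singleValued (h01 : zero ≠ one) (hN : ∀ l, (N.stm l).SingleValued) :
    N.fn.SingleValued := by
  -- Single-valuedness is continuity for the discrete topologies.
  let _ (i : Fin (L + 1)) : TopologicalSpace (X i) := ⊥
  have (i : Fin (L + 1)) : DiscreteTopology (X i) := ⟨rfl⟩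
  exact (fn_isContinuous h01 fun l => (hN l).isContinuous).1

end GTM

/-! ### Approximation by primitive recursive functions -/

/-- Some coding of a finite type. -/
@[reducible]
noncomputable def primcodableOfFinite (α : Type) [Finite α] : Primcodable α :=
  .ofEquiv (Fin (Nat.card α)) (Finite.equivFin α)

section Primrec

variable {α β γ δ : Type} [Primcodable α] [Primcodable β] [Primcodable γ] [Primcodable δ]

theorem primrec₂_of_finite {α : Type} [Primcodable α] [Finite α] {f : α → β → γ}
    (h : ∀ a, Primrec (f a)) : Primrec₂ f := by
  have e := Finite.equivFin α
  have hf : Primrec₂ fun i => f (e.symm i) := Primrec.fin_curry₁.2 fun i => h (e.symm i)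
  exact (hf.comp ((Primrec.dom_finite e).comp .fst) .snd).of_eq fun x => by simp

theorem primrec_option_elim {o : α → Option β} {f : α → γ} {g : α → β → γ} (ho : Primrec o)
    (hf : Primrec f) (hg : Primrec₂ g) : Primrec fun a => (o a).elim (f a) (g a) :=
  (Primrec.option_casesOn ho hf hg).of_eq fun a => by cases o a <;> rfl

theorem primrec_sum_elim {o : α → β ⊕ γ} {f : α → β → δ} {g : α → γ → δ} (ho : Primrec o)
    (hf : Primrec₂ f) (hg : Primrec₂ g) : Primrec fun a => (o a).elim (f a) (g a) :=
  (Primrec.sumCasesOn ho hf hg).of_eq fun a => by cases o a <;> rfl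

theorem primrec_update {n : ℕ} (i : Fin n) :
    Primrec₂ fun (f : Fin n → α) (a : α) => Function.update f i a := by
  refine Primrec.fin_curry.2 (Primrec₂.swap (Primrec.fin_curry₁.2 fun j => ?_))
  by_cases h : j = i
  · subst h
    simpa using Primrec.snd
  · simp only [Function.update_of_ne h]
    exact Primrec.fin_app.comp .fst (.const j)

theorem primrec_pi_map {n : ℕ} {f : Fin n → α → β} (hf : ∀ j, Primrec (f j)) :
    Primrec fun (x : Fin n → α) j => f j (x j) :=
  Primrec.fin_curry.2 ((Primrec.fin_curry₁.2 hf).comp .snd Primrec.fin_app)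

theorem primrec_intEquivNatSumNat : Primrec Equiv.intEquivNatSumNat :=
  Primrec.encode_iff.1 (Primrec.encode.of_eq fun z => by cases z <;> rfl)

theorem primrec_int_ofNat : Primrec Int.ofNat :=
  Primrec.encode_iff.1 Primrec.nat_double

theorem primrec_int_negSucc : Primrec Int.negSucc :=
  Primrec.encode_iff.1 Primrec.nat_double_succ

theorem primrec_int_casesOn {z : α → ℤ} {f g : α → ℕ → γ} (hz : Primrec z) (hf : Primrec₂ f)
    (hg : Primrec₂ g) : Primrec fun a => (z a).casesOn (motive := fun _ => γ) (f a) (g a) :=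
  (Primrec.sumCasesOn (primrec_intEquivNatSumNat.comp hz) hf hg).of_eq fun a => by
    cases z a <;> rfl

theorem primrec_int_succ : Primrec fun z : ℤ => z + 1 :=
  (primrec_int_casesOn .id (primrec_int_ofNat.comp (Primrec.succ.comp .snd)).to₂
    (Primrec.nat_casesOn .snd (.const 0) (primrec_int_negSucc.comp .snd).to₂).to₂).of_eq fun z => by
      rcases z with n | _ | n <;> rfl

theorem primrec_int_pred : Primrec fun z : ℤ => z - 1 :=
  (primrec_int_casesOn .id
    (Primrec.nat_casesOn .snd (.const (-1)) (primrec_int_ofNat.comp .snd).to₂).to₂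
    (primrec_int_negSucc.comp (Primrec.succ.comp .snd)).to₂).of_eq fun z => by
      rcases z with (_ | n) | n
      · rfl
      · exact (add_sub_cancel_right (n : ℤ) 1).symm
      · rfl

end Primrec

section Approximation

variable {S : Type}

/-- The word `l` approximates a sequence: a word only approximates itself, and an infinite sequence
is approximated by its prefixes; `m` is a lower bound for their length. -/
def Approx : (t : Kind) → ℕ → List S → Str S t → Prop
  | .word, _, l, w => l = (w : List S)
  | .stream, m, l, q => m ≤ l.length ∧ ∀ i a, l[i]? = some a → a = (q : ℕ → S) i

theorem Approx.mono {t : Kind} {m m' : ℕ} {l : List S} {x : Str S t} (h : Approx t m l x)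
    (hm : m' ≤ m) : Approx t m' l x := by
  cases t with
  | word => exact h
  | stream => exact ⟨hm.trans h.1, h.2⟩

theorem Approx.symbolAt {t : Kind} {m : ℕ} {l : List S} {x : Str S t} (h : Approx t m l x) {i : ℕ}
    {a : S} (ha : l[i]? = some a) : x.symbolAt i = some a := by
  cases t with
  | word =>
    obtain rfl : l = x := h
    simpa [Str.symbolAt] using ha
  | stream => simp [Str.symbolAt, h.2 i a ha]

/-- The symbol in cell `z` of a tape that holds a sequence approximated by `l`; the outer `none`
means that `l` does not determine the symbol. -/
def lookup (t : Kind) (l : List S) (z : ℤ) : Option (Option S) :=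
  z.casesOn (fun i => match t with
    | .word => some l[i]?
    | .stream => l[i]?.map some) fun _ => some none

theorem primrec_lookup [Primcodable S] (t : Kind) : Primrec₂ (lookup (S := S) t) := by
  have hget : Primrec₂ fun (x : List S × ℤ) (i : ℕ) => x.1[i]? :=
    Primrec.list_getElem?.comp (Primrec.fst.comp .fst) .snd
  refine primrec_int_casesOn (z := fun x : List S × ℤ => x.2) .snd ?_ (.const _)
  cases t with
  | word => exact Primrec.option_some.comp hget
  | stream => exact Primrec.option_map hget (Primrec.option_some.comp .snd).to₂

theorem Approx.lookup_sound {t : Kind} {m : ℕ} {l : List S} {x : Str S t} (h : Approx t m l x)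
    {z : ℤ} {a : Option S} (ha : lookup t l z = some a) : x.symbolAt z = a := by
  cases t with
  | word =>
    obtain rfl : l = x := h
    cases z <;> simpa [lookup, Str.symbolAt] using ha
  | stream =>
    cases z with
    | ofNat i =>
      obtain ⟨b, hb, rfl⟩ := Option.map_eq_some_iff.1 ha
      exact h.symbolAt hb
    | negSucc i => simpa [lookup, Str.symbolAt] using ha

theorem Approx.lookup_ne_none {t : Kind} {m : ℕ} {l : List S} {x : Str S t} (h : Approx t m l x)
    {z : ℤ} (hz : z < m) : lookup t l z ≠ none := by
  cases z with
  | negSucc i => simp [lookup]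
  | ofNat i =>
    cases t with
    | word => simp [lookup]
    | stream => simpa [lookup] using (Int.ofNat_lt.1 hz).trans_le h.1

variable [Primcodable S] {n : ℕ} {Y : Fin n → Kind} {Y₀ : Kind}

/-- The primitive recursive function `sim` on words approximates `f`: with the bound `N` for the
effort, it yields approximations of `f` from approximations of the arguments. -/
structure IsApproximatedBy (f : MultiFun (∀ j, Str S (Y j)) (Str S Y₀))
    (sim : ℕ → (Fin n → List S) → Option (List S)) : Prop where
  primrec : Primrec₂ sim
  sound : ∀ {p y N ls l}, y ∈ f p → (∀ j, Approx (Y j) 0 (ls j) (p j)) → sim N ls = some l →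
    Approx Y₀ 0 l y
  complete : ∀ {p y}, y ∈ f p → ∀ m, ∃ m', ∀ N ≥ m', ∀ ls,
    (∀ j, Approx (Y j) m' (ls j) (p j)) → ∃ l, sim N ls = some l ∧ Approx Y₀ m l y

theorem IsApproximatedBy.mono {f g : MultiFun (∀ j, Str S (Y j)) (Str S Y₀)}
    {sim : ℕ → (Fin n → List S) → Option (List S)} (hg : IsApproximatedBy g sim)
    (h : ∀ p, f p ⊆ g p) : IsApproximatedBy f sim where
  primrec := hg.primrec
  sound hy := hg.sound (h _ hy)
  complete hy := hg.complete (h _ hy)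

/-- `f` is approximated by some primitive recursive function on words. -/
def IsApproximable (Y : Fin n → Kind) (Y₀ : Kind)
    (f : MultiFun (∀ j, Str S (Y j)) (Str S Y₀)) : Prop :=
  ∃ sim, IsApproximatedBy f sim

end Approximation

/-! ### Type-2 machines are approximable -/

namespace Type2Machine

open StateTransition Turing

section Reachability

variable {S : Type} {n : ℕ} {M : Type2Machine S n} {Y : Fin n → Kind} {p : ∀ j, Str S (Y j)}

theorem reaches_of_run {s : ℕ} {c : M.Cfg} (h : M.run p s = some c) :
    Reaches (M.step p) M.init c := by
  induction s generalizing c with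
  | zero => exact Option.some_inj.1 h ▸ .refl
  | succ s ih =>
    obtain ⟨c₀, h₀, h₁⟩ := Option.bind_eq_some_iff.1 h
    exact (ih h₀).tail h₁

theorem mem_fn_word {w : List S} (h : w ∈ M.fn Y .word p) :
    ∃ c ∈ eval (M.step p) M.init, c.out = w := by
  obtain ⟨s, c, hs, hc, hw⟩ := h
  exact ⟨c, mem_eval.2 ⟨reaches_of_run hs, hc⟩, hw⟩

theorem mem_fn_stream {q : ℕ → S} (h : q ∈ M.fn Y .stream p) (m : ℕ) :
    ∃ c, Reaches (M.step p) M.init c ∧ c.out[m]? = some (q m) := by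
  obtain ⟨s, c, hs, hc⟩ := h.2 m
  exact ⟨c, reaches_of_run hs, hc⟩

theorem getElem?_of_prefix {l l' : List S} (h : l <+: l') {i : ℕ} {a : S} (ha : l[i]? = some a) :
    l'[i]? = some a := by
  obtain ⟨hi, rfl⟩ := List.getElem?_eq_some_iff.1 ha
  exact List.prefix_iff_getElem?.1 h i hi

theorem out_prefix_of_reaches {c c' : M.Cfg} (h : Reaches (M.step p) c c') : c.out <+: c'.out := by
  induction h with
  | refl => exact List.prefix_rfl
  | tail _ hs ih =>
    obtain ⟨a, -, rfl⟩ := Option.map_eq_some_iff.1 hs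
    exact ih.trans (List.prefix_append _ _)

end Reachability

section Zipper

variable {W : Type} [Inhabited W]

/-- A tape, given by the inscription to the left of the head (in reverse) and from the head on. -/
def zipTape (x : List W × List W) : Tape W := Tape.mk' (ListBlank.mk x.1) (ListBlank.mk x.2)

/-- Write under the head of a tape in the encoding of `zipTape`, then move. -/
def zipMove : Option Dir → W → List W × List W → List W × List W
  | none, a, x => (x.1, a :: x.2.tail)
  | some .left, a, x => (x.1.tail, x.1.headI :: a :: x.2.tail)
  | some .right, a, x => (a :: x.1, x.2.tail)

theorem zipTape_zipMove (d : Option Dir) (a : W) (x : List W × List W) :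
    zipTape (zipMove d a x) = moveTape d ((zipTape x).write a) := by
  rcases d with _ | _ | _ <;> simp [zipTape, zipMove, moveTape]

theorem primrec_zipMove [Primcodable W] (d : Option Dir) (a : W) : Primrec (zipMove d a) := by
  have htail : Primrec fun x : List W × List W => x.2.tail := Primrec.list_tail.comp .snd
  have hcons : Primrec fun x : List W × List W => a :: x.2.tail :=
    Primrec.list_cons.comp (.const a) htail
  rcases d with _ | _ | _
  · exact Primrec.fst.pair hcons
  · exact (Primrec.list_tail.comp .fst).pair
      (Primrec.list_cons.comp (Primrec.list_headI.comp .fst) hcons)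
  · exact (Primrec.list_cons.comp (.const a) .fst).pair htail

end Zipper

theorem primrec_add_shift (d : Option Dir) : Primrec fun z : ℤ => z + shift d := by
  rcases d with _ | _ | _
  · exact Primrec.id.of_eq fun z => (add_zero z).symm
  · exact primrec_int_pred
  · exact primrec_int_succ

variable {S : Type} {n : ℕ} {M : Type2Machine S n}

variable (M) in
/-- Configurations with finite descriptions of the work tapes, as in `zipTape`. -/
@[ext]
structure FinCfg where
  state : M.State
  inHead : Fin n → ℤ
  work : Fin M.numWork → List M.Work × List M.Work
  out : List S

namespace FinCfg

/-- The configuration that is described. -/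
def toCfg (c : M.FinCfg) : M.Cfg where
  state := c.state
  inHead := c.inHead
  work r := zipTape (c.work r)
  out := c.out

variable (M) in
/-- The initial configuration. -/
def init : M.FinCfg := ⟨M.start, fun _ => 0, fun _ => ([], []), []⟩

/-- The result of an action. -/
def apply (c : M.FinCfg) (a : Action S M.State M.Work n M.numWork) : M.FinCfg where
  state := a.next
  inHead j := c.inHead j + shift (a.inMove j)
  work r := zipMove (a.workMove r) (a.write r) (c.work r)
  out := c.out ++ a.out.toList

variable (M) in
open Classical in
/-- The action for partially known symbols on the input tapes: `none` if some of them is unknown,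
and `some none` if the machine halts. -/
noncomputable def action (x : M.State × (Fin n → Option (Option S)) × (Fin M.numWork → M.Work)) :
    Option (Option (Action S M.State M.Work n M.numWork)) :=
  if ∀ j, x.2.1 j ≠ none then some (M.δ x.1 (fun j => (x.2.1 j).getD none) x.2.2) else none

variable (Y : Fin n → Kind)

/-- One step on approximations of the inputs: `none` if unknown symbols are needed, and `some none`
if the machine halts. -/
noncomputable def step (ls : Fin n → List S) (c : M.FinCfg) : Option (Option M.FinCfg) :=
  (action M (c.state, fun j => lookup (Y j) (ls j) (c.inHead j), fun r => (c.work r).2.headI)).map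
    (Option.map c.apply)

/-- One step if it is possible. -/
noncomputable def next (ls : Fin n → List S) (c : M.FinCfg) : M.FinCfg :=
  ((step Y ls c).getD none).getD c

variable (M) in
/-- The approximation of the result that is available after `N` steps on approximations of the
inputs: a word is only known when the machine has halted. -/
noncomputable def result : Kind → ℕ → (Fin n → List S) → Option (List S)
  | .word, N, ls =>
    let c := (next Y ls)^[N] (init M)
    (step Y ls c).bind fun o => o.elim (some c.out) fun _ => none
  | .stream, N, ls => some ((next Y ls)^[N] (init M)).out

section Primrec

variable [Primcodable S] [Primcodable M.State] [Primcodable M.Work]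

def equivProd : M.FinCfg ≃
    M.State × (Fin n → ℤ) × (Fin M.numWork → List M.Work × List M.Work) × List S where
  toFun c := (c.state, c.inHead, c.work, c.out)
  invFun x := ⟨x.1, x.2.1, x.2.2.1, x.2.2.2⟩

instance primcodable : Primcodable M.FinCfg := .ofEquiv _ equivProd

theorem primrec_state : Primrec (state : M.FinCfg → _) := Primrec.fst.comp .of_equiv

theorem primrec_inHead : Primrec (inHead : M.FinCfg → _) :=
  (Primrec.fst.comp .snd).comp .of_equiv

theorem primrec_work : Primrec (work : M.FinCfg → _) :=
  (Primrec.fst.comp (Primrec.snd.comp .snd)).comp .of_equiv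

theorem primrec_out : Primrec (out : M.FinCfg → _) :=
  (Primrec.snd.comp (Primrec.snd.comp .snd)).comp .of_equiv

theorem primrec_apply (a : Action S M.State M.Work n M.numWork) :
    Primrec fun c : M.FinCfg => c.apply a := by
  have hHead : Primrec fun c : M.FinCfg => (c.apply a).inHead :=
    (primrec_pi_map fun j => primrec_add_shift (a.inMove j)).comp primrec_inHead
  have hWork : Primrec fun c : M.FinCfg => (c.apply a).work :=
    (primrec_pi_map fun r => primrec_zipMove (a.workMove r) (a.write r)).comp primrec_work
  have hOut : Primrec fun c : M.FinCfg => (c.apply a).out :=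
    Primrec.list_append.comp primrec_out (.const a.out.toList)
  exact (Primrec.of_equiv_iff equivProd).1 ((Primrec.const a.next).pair
    (hHead.pair (hWork.pair hOut)))

variable [Finite S]

theorem primrec_step : Primrec₂ (step (M := M) Y) := by
  have hact : Primrec₂ fun x (c : M.FinCfg) => (action M x).map (Option.map c.apply) := by
    refine primrec₂_of_finite fun x => ?_
    rcases action M x with _ | _ | a
    · exact .const none
    · exact .const (some none)
    · exact Primrec.option_some.comp (Primrec.option_some.comp (primrec_apply a))
  have hsymbols : Primrec₂ fun (ls : Fin n → List S) (c : M.FinCfg) (j : Fin n) =>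
      lookup (Y j) (ls j) (c.inHead j) := by
    refine Primrec.fin_curry.2 (Primrec₂.swap (Primrec.fin_curry₁.2 fun j => ?_))
    exact (primrec_lookup (Y j)).comp (Primrec.fin_app.comp .fst (.const j))
      (Primrec.fin_app.comp (primrec_inHead.comp .snd) (.const j))
  have hheads : Primrec fun (c : M.FinCfg) r => (c.work r).2.headI :=
    (primrec_pi_map fun _ => Primrec.list_headI.comp .snd).comp primrec_work
  exact hact.comp ((primrec_state.comp .snd).pair (Primrec.pair hsymbols (hheads.comp .snd))) .snd

theorem primrec_next : Primrec₂ (next (M := M) Y) :=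
  Primrec.option_getD.comp (Primrec.option_getD.comp (primrec_step Y) (.const none)) .snd

theorem primrec_result (Y₀ : Kind) : Primrec₂ (result M Y Y₀) := by
  have hiter : Primrec₂ fun N ls => (next Y ls)^[N] (init M) :=
    Primrec.nat_iterate .fst (.const _) ((primrec_next Y).comp (Primrec.snd.comp .fst) .snd).to₂
  cases Y₀ with
  | word =>
    exact Primrec.option_bind ((primrec_step Y).comp .snd hiter) (primrec_option_elim .snd
      (Primrec.option_some.comp (primrec_out.comp (hiter.comp (Primrec.fst.comp .fst)
        (Primrec.snd.comp .fst)))) (.const none)).to₂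
  | stream => exact Primrec.option_some.comp (primrec_out.comp hiter)

end Primrec

section Correctness

variable {Y} {p : ∀ j, Str S (Y j)} {ls : Fin n → List S} {m : ℕ}

theorem step_sound (h : ∀ j, Approx (Y j) m (ls j) (p j)) {c : M.FinCfg} {o : Option M.FinCfg}
    (ho : step Y ls c = some o) : M.step p c.toCfg = o.map toCfg := by
  obtain ⟨o', ho', rfl⟩ := Option.map_eq_some_iff.1 ho
  unfold action at ho'
  split_ifs at ho' with hknown
  obtain rfl := Option.some_inj.1 ho'
  have hsymbols (j : Fin n) : (lookup (Y j) (ls j) (c.inHead j)).getD none =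
      (p j).symbolAt (c.inHead j) := by
    obtain ⟨a, ha⟩ := Option.ne_none_iff_exists'.1 (hknown j)
    simp only at ha
    rw [ha, (h j).lookup_sound ha, Option.getD_some]
  simp only [hsymbols, Option.map_map]
  refine Option.map_congr fun a _ => ?_
  simp only [toCfg, apply, Function.comp_apply, zipTape_zipMove]

theorem step_ne_none (h : ∀ j, Approx (Y j) m (ls j) (p j)) {c : M.FinCfg}
    (hc : ∀ j, c.inHead j < m) : step Y ls c ≠ none := by
  have hknown (j : Fin n) : lookup (Y j) (ls j) (c.inHead j) ≠ none :=
    (h j).lookup_ne_none (hc j)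
  simp [step, action, hknown]

theorem reaches_next (h : ∀ j, Approx (Y j) m (ls j) (p j)) (c : M.FinCfg) :
    Reaches (M.step p) c.toCfg (next Y ls c).toCfg := by
  rw [next]
  rcases ho : step Y ls c with _ | _ | c'
  · exact .refl
  · exact .refl
  · exact .single (step_sound h ho)

theorem reaches_iterate_next (h : ∀ j, Approx (Y j) m (ls j) (p j)) (c : M.FinCfg) (N : ℕ) :
    Reaches (M.step p) c.toCfg ((next Y ls)^[N] c).toCfg := by
  induction N with
  | zero => exact .refl
  | succ N ih =>
    rw [Function.iterate_succ_apply']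
    exact ih.trans (reaches_next h _)

theorem exists_step_sound (p : ∀ j, Str S (Y j)) (c : M.Cfg) :
    ∃ m, ∀ ls, (∀ j, Approx (Y j) m (ls j) (p j)) → ∀ d : M.FinCfg, d.toCfg = c →
      ∃ o, step Y ls d = some o ∧ M.step p c = o.map toCfg := by
  obtain ⟨b, hb⟩ := (Set.finite_range c.inHead).bddAbove
  refine ⟨b.toNat + 1, fun ls h d hd => ?_⟩
  subst hd
  have hhead (j : Fin n) : d.inHead j < (b.toNat + 1 : ℕ) := by
    have : d.inHead j ≤ b := hb (Set.mem_range_self j)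
    omega
  obtain ⟨o, ho⟩ := Option.ne_none_iff_exists'.1 (step_ne_none h hhead)
  exact ⟨o, ho, step_sound h ho⟩

theorem exists_iterate_next_eq {c : M.Cfg} (hc : Reaches (M.step p) M.init c) :
    ∃ s m, ∀ ls, (∀ j, Approx (Y j) m (ls j) (p j)) → ((next Y ls)^[s] (init M)).toCfg = c := by
  induction hc with
  | refl => exact ⟨0, 0, fun _ _ => rfl⟩
  | @tail c c' _ hs ih =>
    obtain ⟨s, m, ih⟩ := ih
    obtain ⟨m', hstep⟩ := exists_step_sound p c
    refine ⟨s + 1, max m m', fun ls h => ?_⟩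
    rw [Function.iterate_succ_apply', next]
    obtain ⟨o, ho, hc'⟩ := hstep ls (fun j => (h j).mono (le_max_right _ _)) _
      (ih ls fun j => (h j).mono (le_max_left _ _))
    rw [ho]
    obtain ⟨d, rfl, hd⟩ := Option.map_eq_some_iff.1 (hc'.symm.trans hs)
    exact hd

theorem result_sound {Y₀ : Kind} {y : Str S Y₀} (hy : y ∈ M.fn Y Y₀ p) {N : ℕ}
    (h : ∀ j, Approx (Y j) m (ls j) (p j)) {l : List S} (hl : result M Y Y₀ N ls = some l) :
    Approx Y₀ 0 l y := by
  have hreach := reaches_iterate_next h (init M) N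
  cases Y₀ with
  | word =>
    obtain ⟨c, hc, rfl⟩ := mem_fn_word hy
    obtain ⟨_ | _, ho, hl⟩ := Option.bind_eq_some_iff.1 hl
    · have hd := mem_eval.2 ⟨hreach, step_sound h ho⟩
      exact Part.mem_unique hd hc ▸ (Option.some_inj.1 hl).symm
    · simp at hl
  | stream =>
    obtain rfl := Option.some_inj.1 hl
    refine ⟨Nat.zero_le _, fun i a ha => ?_⟩
    obtain ⟨c, hc, hi⟩ := mem_fn_stream hy i
    rcases reaches_total hreach hc with hle | hle
    · exact Option.some_inj.1 ((getElem?_of_prefix (out_prefix_of_reaches hle) ha).symm.trans hi)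
    · exact Option.some_inj.1 (ha.symm.trans (getElem?_of_prefix (out_prefix_of_reaches hle) hi))

theorem exists_result_word {w : List S} (hw : w ∈ M.fn Y .word p) :
    ∃ m, ∀ N ≥ m, ∀ ls, (∀ j, Approx (Y j) m (ls j) (p j)) → result M Y .word N ls = some w := by
  obtain ⟨c, hc, rfl⟩ := mem_fn_word hw
  obtain ⟨hreach, hhalt⟩ := mem_eval.1 hc
  obtain ⟨s, m, hm⟩ := exists_iterate_next_eq hreach
  obtain ⟨m', hstep⟩ := exists_step_sound p c
  refine ⟨max s (max m m'), fun N hN ls h => ?_⟩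
  have hs := hm ls fun j => (h j).mono (by omega)
  obtain ⟨o, ho, hc'⟩ := hstep ls (fun j => (h j).mono (by omega)) _ hs
  obtain rfl := Option.map_eq_none_iff.1 (hc'.symm.trans hhalt)
  have hfix : Function.IsFixedPt (next Y ls) ((next Y ls)^[s] (init M)) := by
    rw [Function.IsFixedPt, next, ho, Option.getD_some, Option.getD_none]
  obtain ⟨r, rfl⟩ := Nat.exists_eq_add_of_le' ((le_max_left _ _).trans hN)
  simp only [result, Function.iterate_add_apply, (hfix.iterate r).eq, ho, Option.bind_some,
    Option.elim_none, ← hs, toCfg]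

theorem exists_length_result_stream {q : ℕ → S} (hq : q ∈ M.fn Y .stream p) (i : ℕ) :
    ∃ m, ∀ N ≥ m, ∀ ls, (∀ j, Approx (Y j) m (ls j) (p j)) →
      ∃ l, result M Y .stream N ls = some l ∧ i ≤ l.length := by
  obtain ⟨c, hreach, hc⟩ := mem_fn_stream hq i
  obtain ⟨s, m, hm⟩ := exists_iterate_next_eq hreach
  refine ⟨max s m, fun N hN ls h => ⟨_, rfl, ?_⟩⟩
  have hs := hm ls fun j => (h j).mono (le_max_right _ _)
  obtain ⟨r, rfl⟩ := Nat.exists_eq_add_of_le' ((le_max_left _ _).trans hN)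
  have hprefix := out_prefix_of_reaches (reaches_iterate_next h ((next Y ls)^[s] (init M)) r)
  rw [hs, ← Function.iterate_add_apply] at hprefix
  exact (List.getElem?_eq_some_iff.1 hc).1.le.trans hprefix.length_le

end Correctness

end FinCfg

theorem isApproximable_fn [Finite S] [Primcodable S] (M : Type2Machine S n) (Y : Fin n → Kind)
    (Y₀ : Kind) : IsApproximable Y Y₀ (M.fn Y Y₀) := by
  let _ := primcodableOfFinite M.State
  let _ := primcodableOfFinite M.Work
  refine ⟨FinCfg.result M Y Y₀, FinCfg.primrec_result Y Y₀,
    fun hy hls hl => FinCfg.result_sound hy hls hl, fun hy m => ?_⟩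
  cases Y₀ with
  | word =>
    obtain ⟨m', h⟩ := FinCfg.exists_result_word hy
    exact ⟨m', fun N hN ls hls => ⟨_, h N hN ls hls, rfl⟩⟩
  | stream =>
    obtain ⟨m', h⟩ := FinCfg.exists_length_result_stream hy m
    refine ⟨m', fun N hN ls hls => ?_⟩
    obtain ⟨l, hl, hlen⟩ := h N hN ls hls
    exact ⟨l, hl, hlen, (FinCfg.result_sound hy hls hl).2⟩

end Type2Machine

theorem IsComputable.isApproximable {S : Type} [Finite S] [Primcodable S] {n : ℕ}
    {Y : Fin n → Kind} {Y₀ : Kind} {f : MultiFun (∀ j, Str S (Y j)) (Str S Y₀)}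
    (hf : IsComputable Y Y₀ f) : IsApproximable Y Y₀ f := by
  obtain ⟨-, _, ⟨M, rfl⟩, hM⟩ := hf
  obtain ⟨sim, hsim⟩ := M.isApproximable_fn Y Y₀
  exact ⟨sim, hsim.mono hM⟩

/-! ### Generalized Turing machines are approximable -/

namespace GTM

section CellApprox

variable {S Γ : Type} {t : Kind} {m : ℕ} {c : List S ⊕ Γ}

/-- Approximation of the content of a cell. -/
def CellApprox (t : Kind) (m : ℕ) : List S ⊕ Γ → Str S t ⊕ Γ → Prop :=
  Sum.LiftRel (Approx t m) Eq

theorem CellApprox.exists_inl {x : Str S t} (h : CellApprox t m c (.inl x)) :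
    ∃ l, c = .inl l ∧ Approx t m l x := by
  cases h with
  | inl h => exact ⟨_, rfl, h⟩

theorem CellApprox.mono {x : Str S t ⊕ Γ} (h : CellApprox t m c x) {m' : ℕ} (hm : m' ≤ m) :
    CellApprox t m' c x :=
  Sum.LiftRel.mono (fun _ _ h => h.mono hm) (fun _ _ h => h) h

theorem CellApprox.eq_inr_iff {x : Str S t ⊕ Γ} (h : CellApprox t m c x) (a : Γ) :
    c = .inr a ↔ x = .inr a := by
  cases h <;> simp_all

end CellApprox

/-- The content of cell `z` of a tape that is given by a list of all changes, the last one first. -/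
def readCell {Γ C : Type} (b : Γ) (l : List (ℤ × (C ⊕ Γ))) (z : ℤ) : C ⊕ Γ :=
  l.foldr (fun x c => if x.1 = z then x.2 else c) (.inr b)

theorem readCell_cons {Γ C : Type} (b : Γ) (y : ℤ) (x : C ⊕ Γ) (l : List (ℤ × (C ⊕ Γ))) (z : ℤ) :
    readCell b ((y, x) :: l) z = if z = y then x else readCell b l z := by
  simp [readCell, eq_comm]

theorem primrec_readCell {Γ C : Type} [Primcodable Γ] [Primcodable C] (b : Γ) :
    Primrec₂ (readCell (C := C) b) :=
  Primrec.list_foldr .fst (.const _) (Primrec.ite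
    (Primrec.eq.comp (Primrec.fst.comp (Primrec.fst.comp .snd)) (Primrec.snd.comp .fst))
    (Primrec.snd.comp (Primrec.fst.comp .snd)) (Primrec.snd.comp .snd)).to₂

variable {S : Type} {zero one : S} {k L : ℕ} {Y : Fin (L + 1) → Kind}

/-- Configurations in which sequences are replaced by approximations and tapes are finitely
described, as in `readCell`. -/
structure ApproxCfg (N : GTM zero one k L fun i => Str S (Y i)) where
  label : N.Lab
  head : Fin (L + 1) → ℤ
  tape : Fin (L + 1) → List (ℤ × (List S ⊕ N.Γ))

variable {N : GTM zero one k L fun i => Str S (Y i)}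

namespace ApproxCfg

/-- The content of the scanned cell. -/
def scan (c : N.ApproxCfg) (i : Fin (L + 1)) : List S ⊕ N.Γ :=
  readCell N.blank (c.tape i) (c.head i)

/-- The approximation of a sequence in the scanned cell, with the junk value `[]` for cells that
contain a letter of the work alphabet. -/
def arg (c : N.ApproxCfg) (i : Fin (L + 1)) : List S := (c.scan i).elim id fun _ => []

def setLabel (c : N.ApproxCfg) (l : N.Lab) : N.ApproxCfg := { c with label := l }

def setHead (c : N.ApproxCfg) (i : Fin (L + 1)) (z : ℤ) : N.ApproxCfg :=
  { c with head := Function.update c.head i z }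

/-- Write `x` under the head of Tape `i`. -/
def setCell (c : N.ApproxCfg) (i : Fin (L + 1)) (x : List S ⊕ N.Γ) : N.ApproxCfg :=
  { c with tape := Function.update c.tape i ((c.head i, x) :: c.tape i) }

variable (N) in
/-- The initial configuration on approximations of the inputs. -/
def init (ls : Fin k → List S) : N.ApproxCfg where
  label := N.start
  head _ := 0
  tape := Fin.cases [] fun i => if h : i.1 < k then [(0, .inl (ls ⟨i.1, h⟩))] else []

open Classical in
/-- The approximation of the result in an accepting configuration. -/
noncomputable def result (c : N.ApproxCfg) : Option (List S) :=
  if c.label = N.final then (readCell N.blank (c.tape 0) 0).elim some fun _ => none else none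

section Primrec

variable [Primcodable S] [Primcodable N.Lab] [Primcodable N.Γ]

def equivProd : N.ApproxCfg ≃
    N.Lab × (Fin (L + 1) → ℤ) × (Fin (L + 1) → List (ℤ × (List S ⊕ N.Γ))) where
  toFun c := (c.label, c.head, c.tape)
  invFun x := ⟨x.1, x.2.1, x.2.2⟩

instance primcodable : Primcodable N.ApproxCfg := .ofEquiv _ equivProd

theorem primrec_label : Primrec (label : N.ApproxCfg → _) := Primrec.fst.comp .of_equiv

theorem primrec_head : Primrec (head : N.ApproxCfg → _) := (Primrec.fst.comp .snd).comp .of_equiv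

theorem primrec_tape : Primrec (tape : N.ApproxCfg → _) := (Primrec.snd.comp .snd).comp .of_equiv

theorem primrec_mk {α : Type} [Primcodable α] {f : α → N.Lab} {g : α → Fin (L + 1) → ℤ}
    {h : α → Fin (L + 1) → List (ℤ × (List S ⊕ N.Γ))} (hf : Primrec f) (hg : Primrec g)
    (hh : Primrec h) : Primrec fun a => (⟨f a, g a, h a⟩ : N.ApproxCfg) :=
  (Primrec.of_equiv_iff equivProd).1 (hf.pair (hg.pair hh))

theorem primrec_head_apply (i : Fin (L + 1)) : Primrec fun c : N.ApproxCfg => c.head i :=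
  Primrec.fin_app.comp primrec_head (.const i)

theorem primrec_tape_apply (i : Fin (L + 1)) : Primrec fun c : N.ApproxCfg => c.tape i :=
  Primrec.fin_app.comp primrec_tape (.const i)

theorem primrec_scan (i : Fin (L + 1)) : Primrec fun c : N.ApproxCfg => c.scan i :=
  (primrec_readCell N.blank).comp (primrec_tape_apply i) (primrec_head_apply i)

theorem primrec_arg (i : Fin (L + 1)) : Primrec fun c : N.ApproxCfg => c.arg i :=
  primrec_sum_elim (primrec_scan i) Primrec₂.right (.const [])

theorem primrec_setLabel : Primrec₂ (setLabel (N := N)) :=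
  primrec_mk .snd (primrec_head.comp .fst) (primrec_tape.comp .fst)

theorem primrec_setHead (i : Fin (L + 1)) : Primrec₂ fun (c : N.ApproxCfg) z => c.setHead i z :=
  primrec_mk (primrec_label.comp .fst) ((primrec_update i).comp (primrec_head.comp .fst) .snd)
    (primrec_tape.comp .fst)

theorem primrec_setCell (i : Fin (L + 1)) : Primrec₂ fun (c : N.ApproxCfg) x => c.setCell i x :=
  primrec_mk (primrec_label.comp .fst) (primrec_head.comp .fst)
    ((primrec_update i).comp (primrec_tape.comp .fst) (Primrec.list_cons.comp
      (((primrec_head_apply i).comp .fst).pair .snd) ((primrec_tape_apply i).comp .fst)))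

theorem primrec_init : Primrec (init N) := by
  refine primrec_mk (.const _) (.const _)
    (Primrec.fin_curry.2 (Primrec₂.swap (Primrec.fin_curry₁.2 fun i => ?_)))
  cases i using Fin.cases with
  | zero => exact .const _
  | succ i =>
    simp only [Fin.cases_succ]
    by_cases h : i.1 < k
    · simp only [h, dite_true]
      exact Primrec.list_cons.comp ((Primrec.const 0).pair (Primrec.sumInl.comp
        (Primrec.fin_app.comp .id (.const _)))) (.const [])
    · simp only [h, dite_false]
      exact .const _

theorem primrec_result : Primrec (result (N := N)) := by
  classical
  refine (Primrec.ite (Primrec.eq.comp primrec_label (.const N.final)) ?_ (.const none)).of_eq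
    fun c => by rw [result]
  exact primrec_sum_elim ((primrec_readCell N.blank).comp (primrec_tape_apply 0) (.const 0))
    (Primrec.option_some.comp .snd).to₂ (.const none)

end Primrec

/-- The configuration `κ` is approximated by `c`. -/
structure Represents (m : ℕ) (c : N.ApproxCfg) (κ : N.Cfg) : Prop where
  label : c.label = κ.label
  head : c.head = κ.head
  tape : ∀ i z, CellApprox (Y i) m (readCell N.blank (c.tape i) z) (κ.tape i z)

namespace Represents

variable {m m' : ℕ} {c : N.ApproxCfg} {κ : N.Cfg}

theorem mono (h : Represents m c κ) (hm : m' ≤ m) : Represents m' c κ :=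
  ⟨h.label, h.head, fun i z => (h.tape i z).mono hm⟩

theorem setLabel (h : Represents m c κ) (l : N.Lab) :
    Represents m (c.setLabel l) (κ.setLabel l) :=
  ⟨rfl, h.head, h.tape⟩

theorem setHead (h : Represents m c κ) (i : Fin (L + 1)) (z : ℤ) :
    Represents m (c.setHead i z) (κ.setHead i z) :=
  ⟨h.label, by simp only [ApproxCfg.setHead, Cfg.setHead, h.head], h.tape⟩

theorem setCell (h : Represents m c κ) (i : Fin (L + 1)) {x : List S ⊕ N.Γ}
    {y : Str S (Y i) ⊕ N.Γ} (hx : CellApprox (Y i) m x y) :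
    Represents m (c.setCell i x) (κ.setCell i y) := by
  refine ⟨h.label, h.head, fun j z => ?_⟩
  rcases eq_or_ne j i with rfl | hj
  · simp only [ApproxCfg.setCell, Cfg.setCell, Function.update_self, readCell_cons, h.head]
    rcases eq_or_ne z (κ.head j) with rfl | hz
    · simpa using hx
    · simpa [hz] using h.tape j z
  · simpa [ApproxCfg.setCell, Cfg.setCell, Function.update_of_ne hj] using h.tape j z

theorem scan (h : Represents m c κ) (i : Fin (L + 1)) :
    CellApprox (Y i) m (c.scan i) (κ.scan i) := by
  rw [ApproxCfg.scan, h.head]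
  exact h.tape i (κ.head i)

theorem arg (h : Represents m c κ) {i : Fin (L + 1)} {x : Str S (Y i)}
    (hx : κ.scan i = .inl x) : Approx (Y i) m (c.arg i) x := by
  obtain ⟨l, hl, hlx⟩ := (hx ▸ h.scan i).exists_inl
  rwa [ApproxCfg.arg, hl]

theorem init {ls : Fin k → List S} {x : ∀ j, Str S (Y (N.inTape j))}
    (h : ∀ j, Approx (Y (N.inTape j)) m (ls j) (x j)) :
    Represents m (ApproxCfg.init N ls) (N.initCfg x) := by
  refine ⟨rfl, rfl, fun i z => ?_⟩
  cases i using Fin.cases with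
  | zero => exact .inr rfl
  | succ i =>
    by_cases hi : i.1 < k
    · rcases eq_or_ne z 0 with rfl | hz
      · simpa [ApproxCfg.init, initCfg, hi, readCell_cons] using .inl (h ⟨i.1, hi⟩)
      · simpa [ApproxCfg.init, initCfg, hi, hz, readCell_cons] using .inr rfl
    · simpa [ApproxCfg.init, initCfg, hi] using .inr rfl

theorem result_sound (h : Represents m c κ) {l : List S} (hl : c.result = some l) {x₀ : Str S (Y 0)}
    (hx₀ : κ.tape 0 0 = .inl x₀) : Approx (Y 0) m l x₀ := by
  obtain ⟨l', hl', hx⟩ := (hx₀ ▸ h.tape 0 0).exists_inl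
  obtain ⟨-, hl⟩ : _ ∧ some l' = some l := by simpa [result, hl'] using hl
  exact Option.some_inj.1 hl ▸ hx

theorem exists_result (h : Represents m c κ) {x₀ : Str S (Y 0)} (hκ : N.AcceptsWith κ x₀) :
    ∃ l, c.result = some l ∧ Approx (Y 0) m l x₀ := by
  obtain ⟨l, hl, hx⟩ := (hκ.2 ▸ h.tape 0 0).exists_inl
  exact ⟨l, by simp [result, hl, h.label.trans hκ.1], hx⟩

end Represents

end ApproxCfg

open ApproxCfg Relation

section Simulation

variable [Primcodable S] [Primcodable N.Lab] [Primcodable N.Γ]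

/-- The function `g` approximates the execution of a statement: with the bound `b` for the effort,
`g b c` is `c` if `c` is not accurate enough. -/
structure SimulatesStm (q : Stm zero one N.Lab N.Γ fun i => Str S (Y i))
    (g : ℕ → N.ApproxCfg → N.ApproxCfg) : Prop where
  primrec : Primrec₂ g
  sound : ∀ {κ κ'}, N.StmStep κ κ' q → ∀ b {c}, Represents 0 c κ →
    g b c = c ∨ Represents 0 (g b c) κ'
  complete : ∀ {κ κ'}, N.StmStep κ κ' q → ∀ m, ∃ m', ∀ b ≥ m', ∀ c, Represents m' c κ →
    Represents m (g b c) κ'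

namespace SimulatesStm

variable {q : Stm zero one N.Lab N.Γ fun i => Str S (Y i)}

theorem of_forall {g : N.ApproxCfg → N.ApproxCfg} (hg : Primrec g)
    (h : ∀ {κ κ'}, N.StmStep κ κ' q → ∀ {m c}, Represents m c κ → Represents m (g c) κ') :
    SimulatesStm q fun _ => g where
  primrec := hg.comp .snd
  sound hκ _ _ hc := .inr (h hκ hc)
  complete hκ m := ⟨m, fun _ _ _ hc => h hκ hc⟩

theorem of_isApproximatedBy {n : ℕ} {is : Fin n → Fin (L + 1)} {Y₀ : Kind}
    {f : MultiFun (∀ j, Str S (Y (is j))) (Str S Y₀)}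
    {sim : ℕ → (Fin n → List S) → Option (List S)} (hf : IsApproximatedBy f sim)
    {g : N.ApproxCfg → List S → N.ApproxCfg} (hg : Primrec₂ g)
    (h : ∀ {κ κ'}, N.StmStep κ κ' q → ∃ x : ∀ j, Str S (Y (is j)),
      (∀ j, κ.scan (is j) = .inl (x j)) ∧ ∃ y ∈ f x, ∀ {m c l}, Represents m c κ →
        Approx Y₀ m l y → Represents m (g c l) κ') :
    SimulatesStm q fun b c => (sim b fun j => c.arg (is j)).elim c (g c) where
  primrec :=
    have hargs : Primrec fun (c : N.ApproxCfg) j => c.arg (is j) :=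
      Primrec.fin_curry.2 (Primrec₂.swap (Primrec.fin_curry₁.2 fun j => primrec_arg (is j)))
    primrec_option_elim (hf.primrec.comp .fst (hargs.comp .snd)) .snd
      (hg.comp (Primrec.snd.comp .fst) .snd).to₂
  sound {κ κ'} hκ b c hc := by
    obtain ⟨x, hx, y, hy, hκ'⟩ := h hκ
    rcases hl : sim b fun j => c.arg (is j) with _ | l
    · exact .inl rfl
    · exact .inr (hκ' hc (hf.sound hy (fun j => hc.arg (hx j)) hl))
  complete {κ κ'} hκ m := by
    obtain ⟨x, hx, y, hy, hκ'⟩ := h hκ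
    obtain ⟨m', hm'⟩ := hf.complete hy m
    refine ⟨max m m', fun b hb c hc => ?_⟩
    obtain ⟨l, hl, hly⟩ := hm' b (le_of_max_le_right hb) _
      fun j => (hc.mono (le_max_right m m')).arg (hx j)
    rw [hl]
    exact hκ' (hc.mono (le_max_left m m')) hly

end SimulatesStm

theorem exists_simulatesStm_assign {i : Fin (L + 1)} {n : ℕ} {is : Fin n → Fin (L + 1)}
    {f : MultiFun (∀ j, Str S (Y (is j))) (Str S (Y i))}
    (hf : IsApproximable (fun j => Y (is j)) (Y i) f) (l' : N.Lab) :
    ∃ g, SimulatesStm (N := N) (.assign i is f l') g := by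
  obtain ⟨sim, hf⟩ := hf
  refine ⟨_, .of_isApproximatedBy hf (g := fun c l => (c.setCell i (.inl l)).setLabel l') ?_ ?_⟩
  · exact primrec_setLabel.comp ((primrec_setCell i).comp .fst (Primrec.sumInl.comp .snd))
      (.const l')
  · rintro κ _ ⟨x, hx, y, hy, rfl⟩
    exact ⟨x, hx, y, hy, fun hc hl => (hc.setCell i (.inl hl)).setLabel l'⟩

theorem exists_simulatesStm_test (h01 : zero ≠ one) {n : ℕ} {is : Fin n → Fin (L + 1)}
    {f : MultiFun (∀ j, Str S (Y (is j))) (Str S .word)}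
    (hf : IsApproximable (fun j => Y (is j)) .word f) {hs : f.SingleValued}
    {hr : ∀ x, f x ⊆ {letter zero, letter one}} (l' l'' : N.Lab) :
    ∃ g, SimulatesStm (N := N) (.test is f hs hr l' l'') g := by
  classical
  obtain ⟨sim, hf⟩ := hf
  refine ⟨_, .of_isApproximatedBy hf
    (g := fun c l => c.setLabel (if l = [zero] then l' else l'')) ?_ ?_⟩
  · exact primrec_setLabel.comp .fst (Primrec.ite (Primrec.eq.comp .snd (.const _))
      (.const _) (.const _))
  · rintro κ _ ⟨x, hx, ⟨hy, rfl⟩ | ⟨hy, rfl⟩⟩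
    · refine ⟨x, hx, _, hy, fun {m c l} hc hl => ?_⟩
      obtain rfl : l = [zero] := hl
      simpa using hc.setLabel l'
    · refine ⟨x, hx, _, hy, fun {m c l} hc hl => ?_⟩
      obtain rfl : l = [one] := hl
      simpa [h01.symm] using hc.setLabel l''

theorem exists_simulatesStm (h01 : zero ≠ one) (q : Stm zero one N.Lab N.Γ fun i => Str S (Y i))
    (hq : q.Uses IsApproximable) : ∃ g, SimulatesStm q g := by
  classical
  cases q with
  | right i l' =>
    refine ⟨fun _ c => (c.setHead i (c.head i + 1)).setLabel l', .of_forall ?_ ?_⟩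
    · exact primrec_setLabel.comp ((primrec_setHead i).comp .id
        (primrec_int_succ.comp (primrec_head_apply i))) (.const l')
    · rintro κ _ rfl m c hc
      exact hc.head ▸ (hc.setHead i _).setLabel l'
  | left i l' =>
    refine ⟨fun _ c => (c.setHead i (c.head i - 1)).setLabel l', .of_forall ?_ ?_⟩
    · exact primrec_setLabel.comp ((primrec_setHead i).comp .id
        (primrec_int_pred.comp (primrec_head_apply i))) (.const l')
    · rintro κ _ rfl m c hc
      exact hc.head ▸ (hc.setHead i _).setLabel l'
  | write i a l' =>
    refine ⟨fun _ c => (c.setCell i (.inr a)).setLabel l', .of_forall ?_ ?_⟩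
    · exact primrec_setLabel.comp ((primrec_setCell i).comp .id (.const _)) (.const l')
    · rintro κ _ rfl m c hc
      exact (hc.setCell i (.inr rfl)).setLabel l'
  | branch i a l' l'' =>
    refine ⟨fun _ c => c.setLabel (if c.scan i = .inr a then l' else l''), .of_forall ?_ ?_⟩
    · exact primrec_setLabel.comp .id (Primrec.ite
        (Primrec.eq.comp (primrec_scan i) (.const _)) (.const _) (.const _))
    · rintro κ κ' hκ m c hc
      have hscan := (hc.scan i).eq_inr_iff a
      rcases hκ with ⟨ha, rfl⟩ | ⟨ha, rfl⟩ <;> simpa [hscan, ha] using hc.setLabel _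
  | assign => exact exists_simulatesStm_assign hq _
  | test => exact exists_simulatesStm_test h01 hq _ _

/-- The function `G` approximates the steps of the machine, in the sense of `SimulatesStm`. -/
structure SimulatesStep (G : ℕ → N.ApproxCfg → N.ApproxCfg) : Prop where
  primrec : Primrec₂ G
  fixed : ∀ b {c}, c.label = N.final → Function.IsFixedPt (G b) c
  sound : ∀ {κ κ'}, N.Step κ κ' → ∀ b {c}, Represents 0 c κ →
    G b c = c ∨ Represents 0 (G b c) κ'
  complete : ∀ {κ κ'}, N.Step κ κ' → ∀ m, ∃ m', ∀ b ≥ m', ∀ c, Represents m' c κ →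
    Represents m (G b c) κ'

theorem exists_simulatesStep (h01 : zero ≠ one) (hN : ∀ l, (N.stm l).Uses IsApproximable) :
    ∃ G : ℕ → N.ApproxCfg → N.ApproxCfg, SimulatesStep G := by
  classical
  have := N.finLab
  choose g hg using fun l => exists_simulatesStm h01 (N.stm l) (hN l)
  let G (b : ℕ) (c : N.ApproxCfg) := if h : c.label = N.final then c else g ⟨c.label, h⟩ b c
  have hG {κ : N.Cfg} (hκ : κ.label ≠ N.final) (b : ℕ) {c : N.ApproxCfg} {m : ℕ}
      (hc : Represents m c κ) : G b c = g ⟨κ.label, hκ⟩ b c := by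
    simp only [G, hc.label, hκ, dite_false]
  refine ⟨G, ?_, fun b c hc => dif_pos hc, ?_, ?_⟩
  · have hcases : Primrec₂ fun (l : N.Lab) (x : ℕ × N.ApproxCfg) =>
        if h : l = N.final then x.2 else g ⟨l, h⟩ x.1 x.2 := by
      refine primrec₂_of_finite fun l => ?_
      split_ifs with h
      · exact .snd
      · exact (hg ⟨l, h⟩).primrec
    exact hcases.comp (primrec_label.comp .snd) .id
  · rintro κ κ' ⟨hl, hκ⟩ b c hc
    rw [hG hl b hc]
    exact (hg _).sound hκ b hc
  · rintro κ κ' ⟨hl, hκ⟩ m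
    obtain ⟨m', hm'⟩ := (hg _).complete hκ m
    refine ⟨m', fun b hb c hc => ?_⟩
    rw [hG hl b hc]
    exact hm' b hb c hc

namespace SimulatesStep

variable {G : ℕ → N.ApproxCfg → N.ApproxCfg} {κ κ' : N.Cfg}

theorem exists_represents_iterate (hG : SimulatesStep G) (h : ReflTransGen N.Step κ κ')
    (hκ' : κ'.label = N.final) (b : ℕ) {c : N.ApproxCfg} (hc : Represents 0 c κ) (s : ℕ) :
    ∃ κ'', ReflTransGen N.Step κ'' κ' ∧ Represents 0 ((G b)^[s] c) κ'' := by
  induction s with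
  | zero => exact ⟨κ, h, hc⟩
  | succ s ih =>
    rw [Function.iterate_succ_apply']
    obtain ⟨κ₀, h₀, hc₀⟩ := ih
    rcases h₀.cases_head with rfl | ⟨κ₁, h₁, h₁'⟩
    · rw [hG.fixed b (hc₀.label.trans hκ')]
      exact ⟨_, h₀, hc₀⟩
    · rcases hG.sound h₁ b hc₀ with heq | hc₁
      · exact ⟨κ₀, h₀, heq.symm ▸ hc₀⟩
      · exact ⟨κ₁, h₁', hc₁⟩

theorem result_sound (hG : SimulatesStep G) {x₀ : Str S (Y 0)} (h : x₀ ∈ N.resultFrom κ) {b : ℕ}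
    {c : N.ApproxCfg} (hc : Represents 0 c κ) {s : ℕ} {l : List S}
    (hl : ((G b)^[s] c).result = some l) : Approx (Y 0) 0 l x₀ := by
  obtain ⟨κ', hκ, hκ'⟩ := h
  obtain ⟨κ'', hκ'', hc''⟩ := hG.exists_represents_iterate hκ hκ'.1 b hc s
  have hfinal : κ''.label = N.final := by
    by_contra hne
    simp [result, hc''.label, hne] at hl
  rcases hκ''.cases_head with rfl | ⟨_, hstep, -⟩
  · exact hc''.result_sound hl hκ'.2
  · exact absurd hfinal hstep.1

theorem exists_iterate_represents (hG : SimulatesStep G) (h : ReflTransGen N.Step κ κ') :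
    ∃ s, ∀ m, ∃ m', ∀ b ≥ m', ∀ c, Represents m' c κ → Represents m ((G b)^[s] c) κ' := by
  induction h with
  | refl => exact ⟨0, fun m => ⟨m, fun _ _ _ hc => hc⟩⟩
  | tail _ hstep ih =>
    obtain ⟨s, ih⟩ := ih
    refine ⟨s + 1, fun m => ?_⟩
    obtain ⟨m₁, hm₁⟩ := hG.complete hstep m
    obtain ⟨m₂, hm₂⟩ := ih m₁
    refine ⟨max m₁ m₂, fun b hb c hc => ?_⟩
    rw [Function.iterate_succ_apply']
    exact hm₁ b (le_of_max_le_left hb) _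
      (hm₂ b (le_of_max_le_right hb) c (hc.mono (le_max_right m₁ m₂)))

theorem exists_result (hG : SimulatesStep G) {x₀ : Str S (Y 0)} (h : x₀ ∈ N.resultFrom κ) (m : ℕ) :
    ∃ m', ∀ b ≥ m', ∀ c, Represents m' c κ →
      ∃ l, ((G b)^[b] c).result = some l ∧ Approx (Y 0) m l x₀ := by
  obtain ⟨κ', hκ, hκ'⟩ := h
  obtain ⟨s, hs⟩ := hG.exists_iterate_represents hκ
  obtain ⟨m', hm'⟩ := hs m
  refine ⟨max m' s, fun b hb c hc => ?_⟩
  have hc' := hm' b (le_of_max_le_left hb) c (hc.mono (le_max_left m' s))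
  obtain ⟨r, hr⟩ := Nat.exists_eq_add_of_le' (le_of_max_le_right hb)
  have hfixed : (G b)^[b] c = (G b)^[s] c := by
    conv_lhs => rw [hr, Function.iterate_add_apply, ← hr]
    exact ((hG.fixed b (hc'.label.trans hκ'.1)).iterate r).eq
  exact hfixed ▸ hc'.exists_result hκ'

end SimulatesStep

end Simulation

theorem isApproximable_fn [Primcodable S] (h01 : zero ≠ one)
    (hN : ∀ l, (N.stm l).Uses IsApproximable) :
    IsApproximable (fun j => Y (N.inTape j)) (Y 0) N.fn := by
  have := N.finLab
  have := N.finΓ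
  let _ := primcodableOfFinite N.Lab
  let _ := primcodableOfFinite N.Γ
  obtain ⟨G, hG⟩ := exists_simulatesStep h01 hN
  refine ⟨fun b ls => ((G b)^[b] (init N ls)).result, ?_, ?_, ?_⟩
  · exact primrec_result.comp (Primrec.nat_iterate .fst (primrec_init.comp .snd)
      (hG.primrec.comp (Primrec.fst.comp .fst) .snd).to₂)
  · intro x x₀ b ls l hx₀ hls hl
    exact hG.result_sound (fn_subset_resultFrom x hx₀) (.init hls) hl
  · intro x x₀ hx₀ m
    obtain ⟨m', hm'⟩ := hG.exists_result (fn_subset_resultFrom x hx₀) m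
    exact ⟨m', fun b hb ls hls => hm' b hb _ (.init hls)⟩

end GTM

/-! ### Evaluation of partial recursive functions by Type-2 machines -/

open Turing Turing.PartrecToTM2 StateTransition

section StackTape

variable {G : Type}

/-- A stack as the inscription of a work tape, with the head on the top of the stack. -/
def stackTape (l : List G) : Tape (Option G) :=
  Tape.mk' (ListBlank.mk []) (ListBlank.mk (l.map some))

theorem stackTape_head (l : List G) : (stackTape l).head = l.head? := by
  cases l <;> rfl

theorem stackTape_write_head (l : List G) : (stackTape l).write l.head? = stackTape l := by
  rw [← stackTape_head, Tape.write_self]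

theorem stackTape_pop (l : List G) : ((stackTape l).write none).move .right = stackTape l.tail := by
  have hblank : ListBlank.cons none (ListBlank.mk []) = (ListBlank.mk [] : ListBlank (Option G)) :=
    ListBlank.ext fun i => by
      cases i
      · rfl
      · simp [ListBlank.cons_mk, ListBlank.nth_mk]
  rw [stackTape, Tape.write_mk', Tape.move_right_mk', ListBlank.head_cons, ListBlank.tail_cons,
    ListBlank.tail_mk, ← List.map_tail, hblank, stackTape]

theorem stackTape_push (l : List G) (x : G) :
    ((stackTape l).move .left).write (some x) = stackTape (x :: l) := by
  rw [stackTape, Tape.move_left_mk', Tape.write_mk', ListBlank.tail_cons, ListBlank.tail_mk,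
    ListBlank.cons_mk]
  rfl

end StackTape

section Codes

theorem trPosNum_ne_nil (a : PosNum) : trPosNum a ≠ [] := by
  cases a <;> simp [trPosNum]

theorem trPosNum_injective : Function.Injective trPosNum := by
  intro a b h
  induction a generalizing b with
  | one => cases b <;> simp [trPosNum, (trPosNum_ne_nil _).symm] at h ⊢
  | bit1 a ih =>
    cases b with
    | bit1 b => rw [ih (List.cons_injective h)]
    | _ => simp [trPosNum, trPosNum_ne_nil] at h
  | bit0 a ih =>
    cases b with
    | bit0 b => rw [ih (List.cons_injective h)]
    | _ => simp [trPosNum] at h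

theorem trNum_injective : Function.Injective trNum := by
  rintro (_ | a) (_ | b) h
  · rfl
  · exact absurd h.symm (trPosNum_ne_nil b)
  · exact absurd h (trPosNum_ne_nil a)
  · exact congrArg _ (trPosNum_injective h)

theorem trNat_injective : Function.Injective trNat := fun a b h => by
  exact_mod_cast trNum_injective h

open ToPartrec.Code in
/-- In `ToPartrec.Code` missing arguments have the value `0`. -/
theorem exists_code₂ {f : ℕ → ℕ → ℕ} (hf : Computable₂ f) :
    ∃ c : ToPartrec.Code, ∀ x l, c.eval (x :: l) = pure [f x l.headI] := by
  obtain ⟨c, hc⟩ := exists_code (Nat.Partrec'.part_iff₂.2 hf.partrec₂)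
  refine ⟨c.comp (cons head (cons tail nil)), fun x l => ?_⟩
  have hargs : c.eval [x, l.headI] = pure [f x l.headI] :=
    (hc ⟨[x, l.headI], rfl⟩).trans (Part.map_some _ _)
  simp only [comp_eval, cons_eval, head_eval, tail_eval, nil_eval, LawfulMonad.pure_bind,
    List.headI_cons, List.tail_cons]
  exact (Part.bind_some _ _).trans hargs

end Codes

/-- A machine that at the time `t = 0, 1, …` evaluates `code` for the code number `enc a` of the
symbols `a` at position `t` on the input tapes and its memory, which is a natural number. The
first value that `code` returns, in the binary representation as a word over `Γ'`, is decoded by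
`dec` to the next action: halt (`none`) or possibly write a symbol. The second value is the new
contents of the memory. Words longer than `bound` need not be decoded. -/
structure Driver (S : Type) (n : ℕ) where
  code : ToPartrec.Code
  enc : (Fin n → Option S) → ℕ
  dec : List Γ' → Option (Option S)
  bound : ℕ

namespace Driver

/-- The statements of the stack machines in `Turing.PartrecToTM2`. -/
abbrev Statement : Type := TM2.Stmt (fun _ : K' => Γ') Λ' (Option Γ')

/-- States of the driver: execution of a statement with the value `v` of the local variable (a push
takes two steps, and `ready` is set in between), decoding of the first value, or reading of the
input. -/
inductive State
  | exec (q : Statement) (v : Option Γ') (ready : Bool)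
  | decode (acc : List Γ')
  | read

/-- Push a word to the main stack, with the first symbol on top. -/
def pushes : List Γ' → Statement → Statement
  | [], q => q
  | x :: w, q => pushes w (.push .main (fun _ => x) q)

theorem stepAux_pushes (w : List Γ') (q : Statement) (v : Option Γ') (l : List Γ') :
    TM2.stepAux (pushes w q) v (K'.elim l [] [] []) =
      TM2.stepAux q v (K'.elim (w ++ l) [] [] []) := by
  induction w generalizing q with
  | nil => rfl
  | cons x w ih => rw [pushes, ih]; simp

/-- The four stacks as the four work tapes of the driver. -/
def tapeEquiv : Fin 4 ≃ K' where
  toFun := ![.main, .rev, .aux, .stack]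
  invFun
    | .main => 0
    | .rev => 1
    | .aux => 2
    | .stack => 3
  left_inv i := by fin_cases i <;> rfl
  right_inv k := by cases k <;> rfl

/-- An action that writes on one work tape and moves its head, moves all input heads in the same
direction `advance`, and possibly writes an output symbol. -/
structure Move (S : Type) where
  next : State
  tape : K'
  write : Option Γ'
  move : Option Dir := none
  advance : Option Dir := none
  out : Option S := none

variable {S : Type} {n : ℕ}

/-- A move as an action; `heads` are the scanned symbols on the work tapes. -/
def Move.toAction (mv : Move S) (heads : Fin 4 → Option Γ') :
    Action S State (Option Γ') n 4 where
  next := mv.next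
  inMove _ := mv.advance
  write := Function.update heads (tapeEquiv.symm mv.tape) mv.write
  workMove := Function.update (fun _ => none) (tapeEquiv.symm mv.tape) mv.move
  out := mv.out

theorem Move.moveTape_toAction (mv : Move S) (w : K' → Tape (Option Γ')) (r : Fin 4) :
    let a : Action S State (Option Γ') n 4 := mv.toAction fun r => (w (tapeEquiv r)).head
    Type2Machine.moveTape (a.workMove r) ((w (tapeEquiv r)).write (a.write r)) =
      Function.update w mv.tape (Type2Machine.moveTape mv.move ((w mv.tape).write mv.write))
        (tapeEquiv r) := by
  obtain ⟨k, rfl⟩ := tapeEquiv.symm.surjective r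
  by_cases hk : k = mv.tape
  · subst hk; simp [Move.toAction]
  · simp [Move.toAction, hk, Type2Machine.moveTape, Tape.write_self]

section Machine

variable (P : Driver S n)

/-- The statement that starts the evaluation of the code after the symbols `a` have been read. -/
def entry (a : Fin n → Option S) : Statement :=
  pushes (trNat (P.enc a) ++ [.cons]) (.goto fun _ => trNormal P.code .halt)

/-- The transition function, where `a` are the symbols on the input tapes and `heads` are those on
the work tapes. -/
def trans (a : Fin n → Option S) (heads : K' → Option Γ') : State → Option (Move S)
  | .exec (.push k f q) v false =>
      some { next := .exec (.push k f q) v true, tape := k, write := heads k, move := some .left }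
  | .exec (.push k f q) v true => some { next := .exec q v false, tape := k, write := some (f v) }
  | .exec (.peek k f q) v _ =>
      some { next := .exec q (f v (heads k)) false, tape := k, write := heads k }
  | .exec (.pop k f q) v _ =>
      some { next := .exec q (f v (heads k)) false, tape := k, write := none, move := some .right }
  | .exec (.load f q) v _ =>
      some { next := .exec q (f v) false, tape := .main, write := heads .main }
  | .exec (.branch f q₁ q₂) v _ =>
      some { next := .exec (cond (f v) q₁ q₂) v false, tape := .main, write := heads .main }
  | .exec (.goto f) v _ =>
      some { next := .exec (tr (f v)) v false, tape := .main, write := heads .main }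
  | .exec .halt _ _ => some { next := .decode [], tape := .main, write := heads .main }
  | .decode acc =>
      match heads .main with
      | none => none
      | some .cons => (P.dec acc).map fun o =>
          { next := .read, tape := .main, write := none, move := some .right,
            advance := some .right, out := o }
      | some x =>
          if acc.length < P.bound then
            some { next := .decode (acc ++ [x]), tape := .main, write := none, move := some .right }
          else none
  | .read => some { next := .exec (P.entry a) none false, tape := .main, write := heads .main }

/-- The statements that the driver executes. -/
def statements : Set Statement :=
  {q | ∃ q₀ ∈ tr '' (codeSupp P.code .halt) ∪ Set.range P.entry, q ∈ TM2.stmts₁ q₀}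

/-- The states that the driver uses. -/
def states : Set State :=
  {s | match s with
    | .exec q _ _ => q ∈ P.statements
    | .decode acc => acc.length ≤ P.bound
    | .read => True}

variable {P}

theorem tr_mem_statements {l : Λ'} (h : l ∈ codeSupp P.code .halt) : tr l ∈ P.statements :=
  ⟨_, .inl ⟨l, h, rfl⟩, TM2.stmts₁_self⟩

theorem entry_mem_statements (a : Fin n → Option S) : P.entry a ∈ P.statements :=
  ⟨_, .inr ⟨a, rfl⟩, TM2.stmts₁_self⟩

theorem statements_of_mem {q q' : Statement} (h : q ∈ P.statements) (h' : q' ∈ TM2.stmts₁ q) :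
    q' ∈ P.statements :=
  let ⟨q₀, hq₀, hq⟩ := h
  ⟨q₀, hq₀, TM2.stmts₁_trans hq h'⟩

theorem statements_finite [Finite S] : P.statements.Finite := by
  have htop : (tr '' (codeSupp P.code .halt) ∪ Set.range P.entry).Finite :=
    ((codeSupp P.code .halt).finite_toSet.image tr).union (Set.finite_range P.entry)
  refine (htop.biUnion fun q _ => (TM2.stmts₁ q).finite_toSet).subset fun q h => ?_
  obtain ⟨q₀, hq₀, hq⟩ := h
  exact Set.mem_biUnion hq₀ hq

theorem states_finite [Finite S] : P.states.Finite := by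
  have hexec : ((fun x : Statement × Option Γ' × Bool => State.exec x.1 x.2.1 x.2.2) ''
      P.statements ×ˢ Set.univ).Finite := (statements_finite.prod Set.finite_univ).image _
  have hdecode : (State.decode '' {acc | acc.length ≤ P.bound}).Finite :=
    (List.finite_length_le Γ' P.bound).image _
  refine ((hexec.union hdecode).union (Set.finite_singleton .read)).subset ?_
  rintro (⟨q, v, b⟩ | acc | _) h
  · exact .inl (.inl ⟨(q, v, b), ⟨h, trivial⟩, rfl⟩)
  · exact .inl (.inr ⟨acc, h, rfl⟩)
  · exact .inr rfl

variable (P) in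
open Classical in
/-- A state of the driver as an element of `P.states`, with the junk value `read` elsewhere. -/
noncomputable def toState (s : State) : P.states :=
  if h : s ∈ P.states then ⟨s, h⟩ else ⟨.read, trivial⟩

theorem toState_val {s : State} (h : s ∈ P.states) : (P.toState s).1 = s := by
  rw [toState, dif_pos h]

variable [Finite S]

variable (P) in
/-- The driver as a Type-2 machine. -/
noncomputable def machine : Type2Machine S n where
  State := P.states
  finState := states_finite.to_subtype
  Work := Option Γ'
  blank := inferInstance
  numWork := 4
  start := P.toState .read
  δ s a heads := (P.trans a (fun k => heads (tapeEquiv.symm k)) s.1).map fun mv =>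
    { mv.toAction heads with next := P.toState mv.next }

variable (P) in
/-- The configuration in the state `s`, with all input heads at position `z`, with the work tapes
`w`, and with the output `o`. -/
noncomputable def tapeCfg (s : State) (z : ℤ) (w : K' → Tape (Option Γ')) (o : List S) :
    P.machine.Cfg where
  state := P.toState s
  inHead _ := z
  work r := w (tapeEquiv r)
  out := o

variable (P) in
/-- The configuration in the state `s`, with all input heads at position `z`, with the stacks `st`
on the work tapes, and with the output `o`. -/
noncomputable def cfg (s : State) (z : ℤ) (st : K' → List Γ') (o : List S) : P.machine.Cfg :=
  P.tapeCfg s z (fun k => stackTape (st k)) o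

variable {Y : Fin n → Kind} (p : ∀ j, Str S (Y j)) {s : State} {z : ℤ}

theorem step_tapeCfg {w : K' → Tape (Option Γ')} {o : List S} {mv : Move S} (hs : s ∈ P.states)
    (h : P.trans (fun j => (p j).symbolAt z) (fun k => (w k).head) s = some mv) :
    P.machine.step p (P.tapeCfg s z w o) =
      some (P.tapeCfg mv.next (z + Type2Machine.shift mv.advance)
        (Function.update w mv.tape (Type2Machine.moveTape mv.move ((w mv.tape).write mv.write)))
        (o ++ mv.out.toList)) := by
  have hδ : P.machine.δ (P.toState s) (fun j => (p j).symbolAt z)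
      (fun r => (w (tapeEquiv r)).head) =
      some { mv.toAction (fun r => (w (tapeEquiv r)).head) with next := P.toState mv.next } := by
    simp only [machine, toState_val hs, Equiv.apply_symm_apply, h, Option.map_some]
  rw [Type2Machine.step, tapeCfg, hδ]
  exact congrArg (fun w' => some (Type2Machine.Cfg.mk (M := P.machine) _ _ w' _))
    (funext (mv.moveTape_toAction (n := n) w))

theorem step_cfg_eq_none {st : K' → List Γ'} {o : List S} (hs : s ∈ P.states)
    (h : P.trans (fun j => (p j).symbolAt z) (fun k => (st k).head?) s = none) :
    P.machine.step p (P.cfg s z st o) = none := by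
  have hδ : P.machine.δ (P.toState s) (fun j => (p j).symbolAt z)
      (fun r => (stackTape (st (tapeEquiv r))).head) = none := by
    simp only [machine, toState_val hs, stackTape_head, Equiv.apply_symm_apply, h, Option.map_none]
  rw [Type2Machine.step, cfg, tapeCfg, hδ]
  rfl

theorem step_cfg_of_idle {s' : State} {k : K'} {st : K' → List Γ'} {o : List S} (hs : s ∈ P.states)
    (h : P.trans (fun j => (p j).symbolAt z) (fun k => (st k).head?) s =
      some { next := s', tape := k, write := (st k).head? }) :
    P.machine.step p (P.cfg s z st o) = some (P.cfg s' z st o) := by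
  rw [cfg, step_tapeCfg p hs (by simpa only [stackTape_head] using h)]
  simp [cfg, Type2Machine.moveTape, Type2Machine.shift, stackTape_write_head]

theorem step_cfg_of_pop {s' : State} {k : K'} {d : Option Dir} {x : Option S} {st : K' → List Γ'}
    {o : List S} (hs : s ∈ P.states)
    (h : P.trans (fun j => (p j).symbolAt z) (fun k => (st k).head?) s = some
      { next := s', tape := k, write := none, move := some .right, advance := d, out := x }) :
    P.machine.step p (P.cfg s z st o) =
      some (P.cfg s' (z + Type2Machine.shift d) (Function.update st k (st k).tail)
        (o ++ x.toList)) := by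
  rw [cfg, step_tapeCfg p hs (by simpa only [stackTape_head] using h)]
  simp only [cfg, Type2Machine.moveTape, stackTape_pop]
  exact congrArg (fun w => some (P.tapeCfg _ _ w _)) (Function.comp_update stackTape st k _).symm

theorem reaches_push {k : K'} {f : Option Γ' → Γ'} {q : Statement} {v : Option Γ'}
    (hq : .push k f q ∈ P.statements) (st : K' → List Γ') (o : List S) :
    Reaches (P.machine.step p) (P.cfg (.exec (.push k f q) v false) z st o)
      (P.cfg (.exec q v false) z (Function.update st k (f v :: st k)) o) := by
  have h₁ := step_tapeCfg p (P := P) (s := .exec (.push k f q) v false) (z := z)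
    (w := fun k => stackTape (st k)) (o := o) hq rfl
  refine .head h₁ (.single ?_)
  rw [Option.mem_def, step_tapeCfg p (P := P) (s := .exec (.push k f q) v true) hq rfl]
  simp only [Type2Machine.moveTape, Function.update_self, stackTape_head, stackTape_write_head,
    stackTape_push, Function.update_idem, Type2Machine.shift, add_zero, Option.toList_none,
    List.append_nil]
  exact congrArg (fun w => some (P.tapeCfg _ _ w _)) (Function.comp_update stackTape st k _).symm

variable (P) in
/-- A configuration of the evaluator as a configuration of the driver. -/
noncomputable def embed (z : ℤ) (o : List S) (C : TM2.Cfg (fun _ : K' => Γ') Λ' (Option Γ')) :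
    P.machine.Cfg :=
  P.cfg (C.l.elim (.decode []) fun l => .exec (tr l) C.var false) z C.stk o

theorem reaches_stepAux (z : ℤ) (o : List S) {q : Statement} (hq : q ∈ P.statements)
    (v : Option Γ') (st : K' → List Γ') :
    Reaches (P.machine.step p) (P.cfg (.exec q v false) z st o)
      (P.embed z o (TM2.stepAux q v st)) := by
  induction q generalizing v st with
  | push k f q ih =>
    exact (reaches_push p hq st o).trans
      (ih (statements_of_mem hq (by simp [TM2.stmts₁, TM2.stmts₁_self])) _ _)
  | peek k f q ih =>
    exact .head (step_cfg_of_idle p hq rfl)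
      (ih (statements_of_mem hq (by simp [TM2.stmts₁, TM2.stmts₁_self])) _ _)
  | pop k f q ih =>
    refine .head ((step_cfg_of_pop p hq rfl).trans ?_)
      (ih (statements_of_mem hq (by simp [TM2.stmts₁, TM2.stmts₁_self])) _ _)
    simp [Type2Machine.shift]
  | load f q ih =>
    exact .head (step_cfg_of_idle p hq rfl)
      (ih (statements_of_mem hq (by simp [TM2.stmts₁, TM2.stmts₁_self])) _ _)
  | branch f q₁ q₂ ih₁ ih₂ =>
    refine .head (step_cfg_of_idle p hq rfl) ?_
    rw [TM2.stepAux]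
    cases f v
    · exact ih₂ (statements_of_mem hq (by simp [TM2.stmts₁, TM2.stmts₁_self])) _ _
    · exact ih₁ (statements_of_mem hq (by simp [TM2.stmts₁, TM2.stmts₁_self])) _ _
  | goto f => exact .single (step_cfg_of_idle p hq rfl)
  | halt => exact .single (step_cfg_of_idle p hq rfl)

theorem reaches_embed (z : ℤ) (o : List S) {C C' : TM2.Cfg (fun _ : K' => Γ') Λ' (Option Γ')}
    (hC : C.l ∈ Finset.insertNone (codeSupp P.code .halt)) (h : Reaches (TM2.step tr) C C') :
    Reaches (P.machine.step p) (P.embed z o C) (P.embed z o C') := by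
  induction h using Relation.ReflTransGen.head_induction_on with
  | refl => exact .refl
  | @head C C₁ h₁ _ ih =>
    have hC₁ : C₁.l ∈ Finset.insertNone (codeSupp P.code .halt) :=
      @TM2.step_supports _ _ _ _ ⟨trNormal P.code .halt⟩ _ tr _ (tr_supports P.code .halt) _ _ h₁ hC
    refine .trans ?_ (ih hC₁)
    obtain ⟨_ | l, v, st⟩ := C
    · exact absurd h₁ (by simp [TM2.step])
    · obtain rfl := Option.some_inj.1 (h₁ : some (TM2.stepAux (tr l) v st) = some C₁)
      exact reaches_stepAux p z o (tr_mem_statements (Finset.some_mem_insertNone.1 hC)) v st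

theorem reaches_decode (acc w l : List Γ') (hw : ∀ x ∈ w, natEnd x = false)
    (hbound : (acc ++ w).length ≤ P.bound) (z : ℤ) (o : List S) :
    Reaches (P.machine.step p) (P.cfg (.decode acc) z (K'.elim (w ++ l) [] [] []) o)
      (P.cfg (.decode (acc ++ w)) z (K'.elim l [] [] []) o) := by
  induction w generalizing acc with
  | nil => rw [List.append_nil]; exact .refl
  | cons x w ih =>
    rw [List.append_cons] at hbound ⊢
    have hlt : acc.length < P.bound := by
      simp only [List.length_append, List.length_cons] at hbound; omega
    refine .head ((step_cfg_of_pop p (k := .main) (s' := .decode (acc ++ [x])) (d := none)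
      (x := none) hlt.le ?_).trans ?_) (ih _ (fun y hy => hw y (.tail x hy)) hbound)
    · have hx : natEnd x = false := hw x (.head w)
      cases x <;> simp_all [trans]
    · simp [Type2Machine.shift]

theorem step_decode_none {acc : List Γ'} (hacc : acc.length ≤ P.bound) (hdec : P.dec acc = none)
    (z : ℤ) (l : List Γ') (o : List S) :
    P.machine.step p (P.cfg (.decode acc) z (K'.elim (.cons :: l) [] [] []) o) = none :=
  step_cfg_eq_none p hacc (by simp [trans, hdec])

theorem step_decode_some {acc : List Γ'} (hacc : acc.length ≤ P.bound) {x : Option S}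
    (hdec : P.dec acc = some x) (z : ℤ) (l : List Γ') (o : List S) :
    P.machine.step p (P.cfg (.decode acc) z (K'.elim (.cons :: l) [] [] []) o) =
      some (P.cfg .read (z + 1) (K'.elim l [] [] []) (o ++ x.toList)) := by
  rw [step_cfg_of_pop p (k := .main) (s' := .read) (d := some .right) (x := x) hacc
    (by simp [trans, hdec])]
  simp [Type2Machine.shift]

theorem reaches_eval {f : (Fin n → Option S) → List ℕ → ℕ × ℕ}
    (hcode : ∀ a l, P.code.eval (P.enc a :: l) = pure [(f a l).1, (f a l).2])
    (hbound : ∀ a l, (trNat (f a l).1).length ≤ P.bound) (z : ℤ) (l : List ℕ) (o : List S) :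
    let r := f (fun j => (p j).symbolAt z) l
    Reaches (P.machine.step p) (P.cfg .read z (K'.elim (trList l) [] [] []) o)
      (P.cfg (.decode (trNat r.1)) z (K'.elim (.cons :: trList [r.2]) [] [] []) o) := by
  set a : Fin n → Option S := fun j => (p j).symbolAt z
  intro r
  have hentry : TM2.stepAux (P.entry a) none (K'.elim (trList l) [] [] []) =
      init P.code (P.enc a :: l) := by
    rw [entry, stepAux_pushes]
    simp [init, trList]
  have heval : halt [r.1, r.2] ∈ eval (TM2.step tr) (init P.code (P.enc a :: l)) := by
    rw [PartrecToTM2.tr_eval, hcode]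
    exact (Part.mem_map_iff _).2 ⟨_, Part.mem_some _, rfl⟩
  have hread := step_cfg_of_idle p (P := P) (s := .read) (st := K'.elim (trList l) [] [] [])
    (z := z) (o := o) trivial rfl
  have hstart := reaches_stepAux p z o (entry_mem_statements (P := P) a) none
    (K'.elim (trList l) [] [] [])
  rw [hentry] at hstart
  exact .head hread <| hstart.trans <|
    (reaches_embed p z o (Finset.some_mem_insertNone.2 (tr_supports P.code .halt).1)
      (mem_eval.1 heval).1).trans <|
    reaches_decode p [] (trNat r.1) _ (trNat_natEnd _) (hbound a l) z o

end Machine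

end Driver

/-! ### Transducers -/

namespace Type2Machine

variable {S : Type} {n : ℕ} {M : Type2Machine S n} {Y : Fin n → Kind} {p : ∀ j, Str S (Y j)}

theorem run_succ {s : ℕ} {c : M.Cfg} (h : M.run p s = some c) : M.run p (s + 1) = M.step p c := by
  rw [run, h, Option.bind_some]

theorem run_of_reaches {c c' : M.Cfg} (hc : Reaches (M.step p) c c') {s : ℕ}
    (h : M.run p s = some c) : ∃ s' ≥ s, M.run p s' = some c' := by
  induction hc with
  | refl => exact ⟨s, le_rfl, h⟩
  | tail _ h₁ ih =>
    obtain ⟨s', hs, h'⟩ := ih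
    exact ⟨s' + 1, by omega, (run_succ h').trans h₁⟩

theorem run_ne_none_of_le {s s' : ℕ} (hs : s ≤ s') (h : M.run p s' ≠ none) : M.run p s ≠ none := by
  induction s', hs using Nat.le_induction with
  | base => exact h
  | succ s' _ ih => exact ih fun h' => h (by rw [run, h', Option.bind_none])

end Type2Machine

/-- A transducer with a memory in `σ` that at the time `t = 0, 1, …` halts (`act` is `none`), or
possibly writes a symbol, and then updates its memory with the symbols at position `t` on the input
tapes. -/
structure Transducer (S : Type) (n : ℕ) (σ : Type) where
  init : σ
  act : σ → Option (Option S)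
  next : (Fin n → Option S) → σ → σ

namespace Transducer

variable {S : Type} {n : ℕ} {σ : Type}

section Function

variable (P : Transducer S n σ) {Y : Fin n → Kind} (p : ∀ j, Str S (Y j))

/-- The memory at the time `t`, if the transducer were never to halt. -/
def mem : ℕ → σ
  | 0 => P.init
  | t + 1 => P.next (fun j => (p j).symbolAt t) (mem t)

/-- The word that has been written before the time `t`, if the transducer were never to halt. -/
def out : ℕ → List S
  | 0 => []
  | t + 1 => out t ++ (P.act (P.mem p t)).join.toList

/-- The multi-function computed by a transducer, with the conventions of `Type2Machine.fn`. -/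
def fn (Y : Fin n → Kind) : (Y₀ : Kind) → MultiFun (∀ j, Str S (Y j)) (Str S Y₀)
  | .word => fun p => {w : List S | ∃ T, (∀ t < T, P.act (P.mem p t) ≠ none) ∧
      P.act (P.mem p T) = none ∧ P.out p T = w}
  | .stream => fun p => {q : ℕ → S | (∀ t, P.act (P.mem p t) ≠ none) ∧
      ∀ m, ∃ T, (P.out p T)[m]? = some (q m)}

end Function

/-- The memory that is encoded by a natural number. The encoding is the one of `Option σ`, since in
this way `0` can stand for the initial memory. -/
def decodeMem [Encodable σ] (P : Transducer S n σ) (m : ℕ) : σ :=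
  ((Encodable.decode m : Option (Option σ)).getD none).getD P.init

section Implements

variable [Primcodable σ]

theorem computable_decodeMem (P : Transducer S n σ) : Computable P.decodeMem :=
  (Computable.decode.option_getD (.const none)).option_getD (.const P.init)

variable [Primcodable S]

/-- The driver `D` simulates the transducer `P`. -/
structure IsImplementedBy (P : Transducer S n σ) (D : Driver S n) : Prop where
  eval_code : ∀ a l, D.code.eval (D.enc a :: l) =
    pure [Encodable.encode (P.act (P.decodeMem l.headI)),
      Encodable.encode (some (P.next a (P.decodeMem l.headI)))]
  dec_trNat : ∀ o : Option (Option S), D.dec (trNat (Encodable.encode o)) = o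
  length_trNat_le : ∀ o : Option (Option S), (trNat (Encodable.encode o)).length ≤ D.bound

variable {P : Transducer S n σ}

theorem exists_isImplementedBy [Finite S] (hact : Computable P.act) (hnext : Computable₂ P.next) :
    ∃ D : Driver S n, P.IsImplementedBy D := by
  let _ : Encodable (Fin n → Option S) := Primcodable.toEncodable
  have hmem : Computable fun x : ℕ × ℕ => P.decodeMem x.2 := P.computable_decodeMem.comp .snd
  obtain ⟨c₁, hc₁⟩ := exists_code₂ (f := fun _ m => Encodable.encode (P.act (P.decodeMem m)))
    (Computable.encode.comp (hact.comp hmem))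
  obtain ⟨c₂, hc₂⟩ := exists_code₂ (f := fun x m =>
      ((Encodable.decode x).map fun a => Encodable.encode (some (P.next a (P.decodeMem m)))).getD 0)
    (((Computable.decode.comp .fst).option_map (Computable.encode.comp
      (Computable.option_some.comp (hnext.comp .snd (hmem.comp .fst)))).to₂).option_getD (.const 0))
  let word : Option (Option S) → List Γ' := fun o => trNat (Encodable.encode o)
  have hword : Function.Injective word := trNat_injective.comp Encodable.encode_injective
  obtain ⟨bound, hbound⟩ := (Set.finite_range fun o => (word o).length).bddAbove
  refine ⟨⟨.cons c₁ c₂, Encodable.encode, Function.invFun word, bound⟩, fun a l => ?_,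
    Function.leftInverse_invFun hword, fun o => hbound ⟨o, rfl⟩⟩
  simp [hc₁, hc₂]

variable [Finite S] {D : Driver S n} {Y : Fin n → Kind} (p : ∀ j, Str S (Y j))

namespace IsImplementedBy

theorem reaches_decode (hD : P.IsImplementedBy D) {T : ℕ} {l : List ℕ}
    (hl : P.decodeMem l.headI = P.mem p T) (o : List S) :
    Reaches (D.machine.step p) (D.cfg .read T (K'.elim (trList l) [] [] []) o)
      (D.cfg (.decode (trNat (Encodable.encode (P.act (P.mem p T))))) T
        (K'.elim (.cons :: trList [Encodable.encode (some (P.mem p (T + 1)))]) [] [] []) o) := by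
  rw [mem, ← hl]
  exact Driver.reaches_eval p (f := fun a l => (Encodable.encode (P.act (P.decodeMem l.headI)),
    Encodable.encode (some (P.next a (P.decodeMem l.headI)))))
    hD.eval_code (fun _ _ => hD.length_trNat_le _) T l o

theorem exists_run (hD : P.IsImplementedBy D) {T : ℕ} (hT : ∀ t < T, P.act (P.mem p t) ≠ none) :
    ∃ s ≥ T, ∃ l, P.decodeMem l.headI = P.mem p T ∧ D.machine.run p s =
      some (D.cfg .read T (K'.elim (trList l) [] [] []) (P.out p T)) := by
  induction T with
  | zero =>
    refine ⟨0, le_rfl, [], by simp [decodeMem, mem], ?_⟩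
    have hblank : (fun r => stackTape (K'.elim [] [] [] [] (Driver.tapeEquiv r))) =
        fun _ => (default : Tape (Option Γ')) := by
      funext r
      fin_cases r <;> rfl
    exact congrArg (fun w => some (Type2Machine.Cfg.mk (M := D.machine) _ _ w _)) hblank.symm
  | succ T ih =>
    obtain ⟨s, hs, l, hl, hrun⟩ := ih fun t ht => hT t (by omega)
    obtain ⟨o, ho⟩ := Option.ne_none_iff_exists'.1 (hT T T.lt_succ_self)
    obtain ⟨s', hs', hrun'⟩ := Type2Machine.run_of_reaches (hD.reaches_decode p hl _) hrun
    refine ⟨s' + 1, by omega, [Encodable.encode (some (P.mem p (T + 1)))], by simp [decodeMem],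
      (Type2Machine.run_succ hrun').trans ?_⟩
    rw [Driver.step_decode_some p (hD.length_trNat_le _) ((hD.dec_trNat _).trans ho), out, ho]
    rfl

theorem fn_subset (hD : P.IsImplementedBy D) (Y₀ : Kind) : P.fn Y Y₀ p ⊆ D.machine.fn Y Y₀ p := by
  intro y hy
  cases Y₀ with
  | word =>
    obtain ⟨T, hT, hnone, rfl⟩ := hy
    obtain ⟨s, -, l, hl, hrun⟩ := hD.exists_run p hT
    obtain ⟨s', -, hrun'⟩ := Type2Machine.run_of_reaches (hD.reaches_decode p hl _) hrun
    exact ⟨s', _, hrun', Driver.step_decode_none p (hD.length_trNat_le _)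
      ((hD.dec_trNat _).trans hnone) _ _ _, rfl⟩
  | stream =>
    refine ⟨fun T => ?_, fun m => ?_⟩
    · obtain ⟨s, hs, l, -, hrun⟩ := hD.exists_run p (T := T) fun t _ => hy.1 t
      exact Type2Machine.run_ne_none_of_le hs (by simp [hrun])
    · obtain ⟨T, hT⟩ := hy.2 m
      obtain ⟨s, -, l, -, hrun⟩ := hD.exists_run p (T := T) fun t _ => hy.1 t
      exact ⟨s, _, hrun, hT⟩

end IsImplementedBy

theorem exists_machine_fn_subset (hact : Computable P.act) (hnext : Computable₂ P.next) :
    ∃ M : Type2Machine S n, ∀ (Y : Fin n → Kind) (Y₀ : Kind) (p : ∀ j, Str S (Y j)),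
      P.fn Y Y₀ p ⊆ M.fn Y Y₀ p :=
  let ⟨D, hD⟩ := exists_isImplementedBy hact hnext
  ⟨D.machine, fun _ Y₀ p => hD.fn_subset p Y₀⟩

end Implements

end Transducer

/-! ### Search for approximations -/

section Take

variable {S : Type}

/-- The prefix of length `m` of a sequence (the whole sequence, if it is a shorter word). -/
def Str.take : {t : Kind} → Str S t → ℕ → List S
  | .word, w, m => List.take m w
  | .stream, q, m => (List.range m).map q

variable {t : Kind} {x : Str S t}

theorem Str.take_zero : x.take 0 = [] := by
  cases t <;> rfl

theorem Str.take_succ (m : ℕ) : x.take (m + 1) = x.take m ++ (x.symbolAt m).toList := by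
  cases t with
  | word => simpa [take, symbolAt] using List.take_add_one
  | stream =>
    let q : ℕ → S := x
    change (List.range (m + 1)).map q = (List.range m).map q ++ [q m]
    rw [List.range_succ, List.map_append, List.map_singleton]

theorem approx_take {m : ℕ} (h : t = .word → (x.take m).length < m) :
    Approx t m (x.take m) x := by
  cases t with
  | word =>
    let w : List S := x
    have hlt : (w.take m).length < m := h rfl
    rw [List.length_take] at hlt
    exact List.take_of_length_le (l := w) (by omega)
  | stream =>
    let q : ℕ → S := x
    have hlen : ((List.range m).map q).length = m := by simp
    refine ⟨hlen.ge, fun i a (ha : ((List.range m).map q)[i]? = some a) => ?_⟩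
    obtain ⟨hi, rfl⟩ := List.getElem?_eq_some_iff.1 ha
    rw [List.getElem_map, List.getElem_range]

theorem eventually_length_take_lt (x : Str S t) :
    ∀ᶠ m in atTop, t = .word → (x.take m).length < m := by
  cases t with
  | word =>
    let w : List S := x
    filter_upwards [eventually_gt_atTop w.length] with m hm _
    exact (List.length_take_le' m w).trans_lt hm
  | stream => exact .of_forall fun _ h => nomatch h

end Take

namespace Search

variable {S : Type} {n : ℕ} (Y : Fin n → Kind) (Y₀ : Kind)
  (sim : ℕ → (Fin n → List S) → Option (List S))

open Classical in
/-- The approximation by `sim` that is obtained from the first `m` cells of the input tapes, after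
the ends of all input words have been seen. -/
noncomputable def result (m : ℕ) (ls : Fin n → List S) : Option (List S) :=
  if ∀ j, Y j = .word → (ls j).length < m then sim m ls else none

/-- The time, the symbols read so far on every input tape, and the number of symbols written so
far. -/
abbrev Memory (S : Type) (n : ℕ) : Type := ℕ × (Fin n → List S) × ℕ

/-- The first symbol of the approximation that has not yet been written. -/
noncomputable def nextSymbol (x : Memory S n) : Option S :=
  (result Y sim x.1 x.2.1).bind fun l => l[x.2.2]?

/-- Whether the output is a word that has been written completely. -/
noncomputable def finished (x : Memory S n) : Bool :=
  match Y₀ with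
  | .word => (result Y sim x.1 x.2.1).isSome && (nextSymbol Y sim x).isNone
  | .stream => false

/-- The transducer that writes the symbols of better and better approximations by `sim`. -/
noncomputable def transducer : Transducer S n (Memory S n) where
  init := (0, fun _ => [], 0)
  act x := if finished Y Y₀ sim x then none else some (nextSymbol Y sim x)
  next a x := (x.1 + 1, fun j => x.2.1 j ++ (a j).toList,
    x.2.2 + (nextSymbol Y sim x).toList.length)

section Primrec

variable [Primcodable S] {Y Y₀ sim}

theorem primrec_result (h : Primrec₂ sim) : Primrec₂ (result Y sim) := by
  classical
  have hlt : Primrec fun (x : ℕ × (Fin n → List S)) (j : Fin n) => decide ((x.2 j).length < x.1) :=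
    Primrec.fin_curry.2 (Primrec.nat_lt.comp
      (Primrec.list_length.comp (Primrec.fin_app.comp (Primrec.snd.comp .fst) .snd))
      (Primrec.fst.comp .fst)).decide
  have hall : Primrec fun b : Fin n → Bool => decide (∀ j, Y j = .word → b j = true) :=
    Primrec.dom_finite _
  refine (Primrec.cond (hall.comp hlt) h (.const none)).of_eq fun x => ?_
  simp only [result, decide_eq_true_eq, Bool.cond_decide]

theorem primrec_nextSymbol (h : Primrec₂ sim) : Primrec (nextSymbol Y sim) :=
  Primrec.option_bind ((primrec_result h).comp .fst (Primrec.fst.comp .snd))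
    (Primrec.list_getElem?.comp .snd (Primrec.snd.comp (Primrec.snd.comp .fst))).to₂

theorem primrec_finished (h : Primrec₂ sim) : Primrec (finished Y Y₀ sim) := by
  cases Y₀ with
  | word =>
    refine Primrec.and.comp
      (Primrec.option_isSome.comp ((primrec_result h).comp .fst (Primrec.fst.comp .snd)))
      ((Primrec.not.comp (Primrec.option_isSome.comp
        (primrec_nextSymbol (Y := Y) h))).of_eq fun x => ?_)
    rw [Option.not_isSome]
  | stream => exact .const _

theorem primrec_act (h : Primrec₂ sim) : Primrec (transducer Y Y₀ sim).act :=
  Primrec.ite (Primrec.eq.comp (primrec_finished h) (.const true)) (.const none)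
    (Primrec.option_some.comp (primrec_nextSymbol h))

theorem primrec_next (h : Primrec₂ sim) : Primrec₂ (transducer Y Y₀ sim).next :=
  (Primrec.succ.comp (Primrec.fst.comp .snd)).pair <| .pair
    (Primrec.fin_curry.2 <| Primrec.list_append.comp
      (Primrec.fin_app.comp (Primrec.fst.comp (Primrec.snd.comp (Primrec.snd.comp .fst))) .snd)
      (Primrec.optionToList.comp (Primrec.fin_app.comp (Primrec.fst.comp .fst) .snd)))
    (Primrec.nat_add.comp (Primrec.snd.comp (Primrec.snd.comp .snd))
      (Primrec.list_length.comp (Primrec.optionToList.comp ((primrec_nextSymbol h).comp .snd))))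

end Primrec

section Run

variable (p : ∀ j, Str S (Y j)) (t : ℕ)

/-- The approximation at the time `t` on the input `p`. -/
noncomputable def resultAt : Option (List S) := result Y sim t fun j => (p j).take t

variable {Y Y₀ sim}

theorem join_act (x : Memory S n) : ((transducer Y Y₀ sim).act x).join = nextSymbol Y sim x := by
  cases Y₀ with
  | word =>
    by_cases h : finished Y .word sim x
    · have hnone : nextSymbol Y sim x = none := by simp_all [finished]
      simp [transducer, h, hnone]
    · simp [transducer, h]
  | stream => simp [transducer, finished]

theorem out_succ : (transducer Y Y₀ sim).out p (t + 1) = (transducer Y Y₀ sim).out p t ++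
    (nextSymbol Y sim ((transducer Y Y₀ sim).mem p t)).toList := by
  rw [Transducer.out, join_act]

theorem mem_eq : (transducer Y Y₀ sim).mem p t =
    (t, fun j => (p j).take t, ((transducer Y Y₀ sim).out p t).length) := by
  induction t with
  | zero => simp [Transducer.mem, Transducer.out, transducer, Str.take_zero]
  | succ t ih =>
    rw [out_succ, Transducer.mem, List.length_append, ih]
    simp only [transducer, Str.take_succ]

theorem nextSymbol_mem : nextSymbol Y sim ((transducer Y Y₀ sim).mem p t) =
    (resultAt Y sim p t).bind fun l => l[((transducer Y Y₀ sim).out p t).length]? := by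
  rw [mem_eq]; rfl

theorem act_mem_eq_none : (transducer Y .word sim).act ((transducer Y .word sim).mem p t) = none ↔
    ∃ l, resultAt Y sim p t = some l ∧ l.length ≤ ((transducer Y .word sim).out p t).length := by
  have hact : (transducer Y .word sim).act ((transducer Y .word sim).mem p t) = none ↔
      (resultAt Y sim p t).isSome ∧ nextSymbol Y sim ((transducer Y .word sim).mem p t) = none := by
    rw [mem_eq]
    simp [transducer, finished, resultAt]
  rw [hact, nextSymbol_mem]
  cases resultAt Y sim p t <;> simp

theorem act_mem_ne_none :
    (transducer Y .stream sim).act ((transducer Y .stream sim).mem p t) ≠ none := by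
  simp [transducer, finished]

theorem le_length_out {m t₀ : ℕ} (h : ∀ t ≥ t₀, ∃ l, resultAt Y sim p t = some l ∧ m ≤ l.length) :
    m ≤ ((transducer Y Y₀ sim).out p (t₀ + m)).length := by
  suffices ∀ i ≤ m, i ≤ ((transducer Y Y₀ sim).out p (t₀ + i)).length from this m le_rfl
  intro i hi
  induction i with
  | zero => exact Nat.zero_le _
  | succ i ih =>
    obtain ⟨l, hl, hm⟩ := h (t₀ + i) (by omega)
    rw [← Nat.add_assoc, out_succ, nextSymbol_mem, hl, Option.bind_some, List.length_append]
    rcases (ih (by omega)).lt_or_eq with hlt | heq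
    · omega
    · rw [← heq, List.getElem?_eq_getElem (by omega)]
      simp

end Run

section Correctness

variable [Primcodable S] {Y Y₀ sim} {f : MultiFun (∀ j, Str S (Y j)) (Str S Y₀)}
  {p : ∀ j, Str S (Y j)} {y : Str S Y₀}

theorem resultAt_sound (hf : IsApproximatedBy f sim) (hy : y ∈ f p) {t : ℕ} {l : List S}
    (hl : resultAt Y sim p t = some l) : Approx Y₀ 0 l y := by
  obtain ⟨hlt, hsim⟩ := Option.ite_none_right_eq_some.1 hl
  exact hf.sound hy (fun j => (approx_take (hlt j)).mono t.zero_le) hsim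

theorem resultAt_complete (hf : IsApproximatedBy f sim) (hy : y ∈ f p) (m : ℕ) :
    ∃ t₀, ∀ t ≥ t₀, ∃ l, resultAt Y sim p t = some l ∧ Approx Y₀ m l y := by
  obtain ⟨m', hm'⟩ := hf.complete hy m
  obtain ⟨t₀, ht₀⟩ := eventually_atTop.1
    ((eventually_ge_atTop m').and (eventually_all.2 fun j => eventually_length_take_lt (p j)))
  refine ⟨t₀, fun t ht => ?_⟩
  obtain ⟨hmt, hlt⟩ := ht₀ t ht
  obtain ⟨l, hl, happ⟩ := hm' t hmt _ fun j => (approx_take (hlt j)).mono hmt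
  exact ⟨l, (if_pos hlt).trans hl, happ⟩

theorem symbolAt_of_getElem?_out (hf : IsApproximatedBy f sim) (hy : y ∈ f p) {t i : ℕ} {a : S}
    (ha : ((transducer Y Y₀ sim).out p t)[i]? = some a) : y.symbolAt i = some a := by
  induction t with
  | zero => simp [Transducer.out] at ha
  | succ t ih =>
    rw [out_succ] at ha
    rcases lt_or_ge i ((transducer Y Y₀ sim).out p t).length with hi | hi
    · exact ih ((List.getElem?_append_left hi).symm.trans ha)
    · rw [List.getElem?_append_right hi, nextSymbol_mem] at ha
      obtain ⟨l, hl, hla⟩ :=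
        Option.bind_eq_some_iff.1 (Option.mem_toList.1 (List.mem_of_getElem? ha))
      have hlt := (List.getElem?_eq_some_iff.1 ha).1.trans_le Option.length_toList_le
      obtain rfl : i = ((transducer Y Y₀ sim).out p t).length := by omega
      exact (resultAt_sound hf hy hl).symbolAt hla

theorem mem_fn_word {f : MultiFun (∀ j, Str S (Y j)) (Str S .word)} {w : List S}
    (hf : IsApproximatedBy f sim) (hw : w ∈ f p) : w ∈ (transducer Y .word sim).fn Y .word p := by
  classical
  have hprefix (t : ℕ) : (transducer Y .word sim).out p t <+: w :=
    List.prefix_iff_getElem?.2 fun i hi => by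
      simpa [Str.symbolAt] using symbolAt_of_getElem?_out hf hw (List.getElem?_eq_getElem hi)
  have hhalt : ∃ t, (transducer Y .word sim).act ((transducer Y .word sim).mem p t) = none := by
    obtain ⟨t₀, ht₀⟩ := resultAt_complete hf hw 0
    refine ⟨t₀ + w.length, (act_mem_eq_none p _).2 ⟨w, ?_, le_length_out p fun t ht => ?_⟩⟩
    · obtain ⟨l, hl, rfl⟩ := ht₀ (t₀ + w.length) (Nat.le_add_right _ _)
      exact hl
    · obtain ⟨l, hl, rfl⟩ := ht₀ t ht
      exact ⟨l, hl, le_rfl⟩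
  refine ⟨Nat.find hhalt, fun t ht => Nat.find_min hhalt ht, Nat.find_spec hhalt, ?_⟩
  obtain ⟨l, hl, hlen⟩ := (act_mem_eq_none p _).1 (Nat.find_spec hhalt)
  obtain rfl : l = w := resultAt_sound hf hw hl
  exact (hprefix _).eq_of_length_le hlen

theorem mem_fn_stream {f : MultiFun (∀ j, Str S (Y j)) (Str S .stream)} {q : ℕ → S}
    (hf : IsApproximatedBy f sim) (hq : q ∈ f p) :
    q ∈ (transducer Y .stream sim).fn Y .stream p := by
  refine ⟨fun t => act_mem_ne_none p t, fun m => ?_⟩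
  obtain ⟨t₀, ht₀⟩ := resultAt_complete hf hq (m + 1)
  have hlen : m + 1 ≤ ((transducer Y .stream sim).out p (t₀ + (m + 1))).length :=
    le_length_out p fun t ht => (ht₀ t ht).imp fun l hl => ⟨hl.1, hl.2.1⟩
  refine ⟨t₀ + (m + 1), ?_⟩
  rw [List.getElem?_eq_getElem hlen]
  simpa [Str.symbolAt, eq_comm] using
    symbolAt_of_getElem?_out hf hq (List.getElem?_eq_getElem hlen)

theorem fn_subset (hf : IsApproximatedBy f sim) (p : ∀ j, Str S (Y j)) :
    f p ⊆ (transducer Y Y₀ sim).fn Y Y₀ p := by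
  cases Y₀ with
  | word => exact fun _ => mem_fn_word hf
  | stream => exact fun _ => mem_fn_stream hf

end Correctness

end Search

theorem IsApproximable.isComputable {S : Type} [Finite S] [Primcodable S] {n : ℕ}
    {Y : Fin n → Kind} {Y₀ : Kind} {f : MultiFun (∀ j, Str S (Y j)) (Str S Y₀)}
    (hf : IsApproximable Y Y₀ f) (hs : f.SingleValued) : IsComputable Y Y₀ f := by
  obtain ⟨sim, h⟩ := hf
  obtain ⟨M, hM⟩ := Transducer.exists_machine_fn_subset
    (Search.primrec_act (Y := Y) (Y₀ := Y₀) h.primrec).to_comp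
    (Search.primrec_next (Y := Y) (Y₀ := Y₀) h.primrec).to_comp
  exact ⟨hs, _, ⟨M, rfl⟩, fun p => (Search.fn_subset h p).trans (hM Y Y₀ p)⟩

end GenTM

theorem mainTheorem7 {S : Type} [Finite S] (zero one : S) (h01 : zero ≠ one) (k L : ℕ)
    (Y : Fin (L + 1) → GenTM.Kind)
    (N : GenTM.GTM zero one k L (fun i => GenTM.Str S (Y i))) :
    ((∀ l, (N.stm l).Uses (fun _ _ f => f.IsContinuous)) → N.fn.IsContinuous) ∧
    ((∀ l, (N.stm l).Uses (fun Z Z₀ f => GenTM.IsComputable Z Z₀ f)) →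
      GenTM.IsComputable (fun j => Y (N.inTape j)) (Y 0) N.fn) := by
  refine ⟨fun hN => GenTM.GTM.fn_isContinuous h01 fun l => (hN l).isContinuous, fun hN => ?_⟩
  have hsingle : N.fn.SingleValued := GenTM.GTM.fn_singleValued h01 fun l =>
    ((hN l).mono fun _ _ _ hf => hf.1).singleValued
  let _ := GenTM.primcodableOfFinite S
  have happrox : GenTM.IsApproximable (fun j => Y (N.inTape j)) (Y 0) N.fn :=
    GenTM.GTM.isApproximable_fn h01 fun l => (hN l).mono fun _ _ _ hf => hf.isApproximable
  exact happrox.isComputable hsingle
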